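/- **Conventions.** $\lambda\in\mathbb N$ is the security parameter. "Efficient" means: computed by Boolean circuits of size polynomial in $\lambda$ whose extra inputs are independent uniform random bits. All objects are encoded by fixed-length bit strings. A statement "$p\le\varepsilon+\mathsf{negl}$" means that there is a negligible function $\nu$ (which may depend on the adversary) with $p(\lambda)\le\varepsilon(\lambda)+\nu(\lambda)$ for all $\lambda$. **Models.** Fix an alphabet $\Sigma$ and an output set $Y$ (both finite), positive integers $n_{\mathsf{model}},n_{\mathsf{qry}},n_{\mathsf{trc}}$, a function $\mathsf{EvalTrace}:\Sigma^{n_{\mathsf{model}}}\times\Sigma^{n_{\mathsf{qry}}}\to\Sigma^{n_{\mathsf{trc}}}$, a set $I\subseteq\{1,\dots,n_{\mathsf{trc}}\}$ of output positions and a function $f_{\mathsf{out}}:\Sigma^{I}\to Y$. Put $\mathsf{out}(t)=f_{\mathsf{out}}((t_j)_{j\in I})$ and $\mathcal M(q)=\mathsf{out}(\mathsf{EvalTrace}(\mathcal M,q))$. Let $\mathcal D,\widetilde{\mathcal D}$ be probability distributions on models, $\mathcal D_{\mathsf{query}}$ one on queries, $\Delta:Y\times Y\to\mathbb R$, $\delta\in\mathbb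 R$, $\varepsilon:\mathbb N\to\mathbb R$. **Idealized scheme.** Let $\mathsf{TestTrace}^{\mathcal M,t}(1^\lambda,q;\rho)\in\{0,1\}$ be an efficient test that adaptively reads positions of $\mathcal M$ and $t$ and uses a uniform random string $\rho$ of polynomial length, and that always accepts $t=\mathsf{EvalTrace}(\mathcal M,q)$. With $\mathcal M\leftarrow\mathcal D$, $\widetilde{\mathcal M}\leftarrow\widetilde{\mathcal D}$, $q\leftarrow\mathcal D_{\mathsf{query}}$ and $\rho$ drawn independently, and $t$ independent of $\rho$, the test is, for all $\lambda$, - *fully sound* with error $\varepsilon$ if for every (unbounded, randomized) $\mathcal A$ and $t\leftarrow\mathcal A(1^\lambda,\mathcal M,q)$: $\Pr[\Delta(\mathcal M(q),\mathsf{out}(t))>\delta\wedge\mathsf{TestTrace}^{\mathcal M,t}(1^\lambda,q;\rho)=1]\le\varepsilon(\lambda)$; - *other-model sound* with error $\varepsilon$ if $\Pr[\Delta(\mathcal M(q),\widetilde{\mathcal M}(q))>\delta\wedge\mathsf{TestTrace}^{\mathcal M,t}(1^\lambda,q;\rho)=1]\le\varepsilon(\lambda)$ for $t=\mathsf{EvalTrace}(\widetilde{\mathcal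 M},q)$; - *strongly other-model sound* with error $\varepsilon$ if for every (unbounded, randomized) $\mathcal A$ and $t\leftarrow\mathcal A(1^\lambda,\mathcal M,q,\widetilde{\mathcal M})$: $\Pr[\Delta(\mathcal M(q),\widetilde{\mathcal M}(q))>\delta\wedge\mathsf{out}(t)=\widetilde{\mathcal M}(q)\wedge\mathsf{TestTrace}^{\mathcal M,t}(1^\lambda,q;\rho)=1]\le\varepsilon(\lambda)$. **Vector commitment.** Let $(\mathsf{GenParams},\mathsf{CommitVec},\mathsf{Open},\mathsf{Verify})$ be a vector commitment over $\Sigma$, with efficient algorithms (for every vector length $n$), the last three deterministic, such that honest openings always verify, and such that for every $n$ and every efficient adversary given $\mathsf{pp}\leftarrow\mathsf{GenParams}(1^\lambda,n)$, the probability is negligible that it outputs a commitment, a position and two accepting openings to different values (binding), and that it outputs $v\in\Sigma^n$, $i$, $y\ne v_i$ and an accepting opening of position $i$ of $\mathsf{CommitVec}(\mathsf{pp},v)$ to $y$ (position binding). **Compiled protocol.** Put $n=\max(n_{\mathsf{model}},n_{\mathsf{trc}})$; vectors to be committed are padded to length $n$ with a fixed symbol. Parameters: $\mathsf{pp}\leftarrow\mathsf{GenParams}(1^\lambda,n)$.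 Model digest: $\mathsf{cm}_{\mathcal M}=\mathsf{CommitVec}(\mathsf{pp},\mathcal M)$. On query $q$ the prover computes $t=\mathsf{EvalTrace}(\mathcal M,q)$ and sends $\pi_1=\mathsf{CommitVec}(\mathsf{pp},t)$; the verifier sends uniform coins $\rho$ of $\mathsf{TestTrace}$; the prover answers with $\pi_2$: values and openings at all positions of $\mathcal M$ and of $t$ that $\mathsf{TestTrace}^{\mathcal M,t}(1^\lambda,q;\rho)$ reads, and at the positions $I$ of $t$. Given a claimed output $y$, the verifier runs $\mathsf{TestTrace}(1^\lambda,q;\rho)$ on the values in $\pi_2$, and accepts iff no value it needs is missing, the test accepts, all openings in $\pi_2$ verify against $\mathsf{cm}_{\mathcal M}$ respectively $\pi_1$, and $\pi_2$ contains values at all positions in $I$ whose image under $f_{\mathsf{out}}$ is $y$. **Theorem.** The compiled protocol is a 3-round verifiable-inference protocol: its algorithms are efficient; it is *binding* (every efficient adversary given $\mathsf{pp}$ finds models $\mathcal M\ne\mathcal M'$ with equal digests only with negligible probability); it is *correct* (for all $\lambda,\mathcal M,q$ the honest prover is accepted on $y=\mathcal M(q)$ with probability $1$). Moreover, with $\mathcal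 M\leftarrow\mathcal D$, $\widetilde{\mathcal M}\leftarrow\widetilde{\mathcal D}$, $q\leftarrow\mathcal D_{\mathsf{query}}$, $\mathsf{pp}$ and $\rho$ drawn independently, and the verifier holding the digest of $\mathcal M$: 1. If $\mathsf{TestTrace}$ is fully sound with error $\varepsilon$, then so is the protocol with error $\varepsilon+\mathsf{negl}$: for all efficient $(\mathcal A_1,\mathcal A_2)$ with $(\tilde y,\pi_1,\mathsf{state})\leftarrow\mathcal A_1(\mathsf{pp},\mathcal M,q)$ and $\pi_2\leftarrow\mathcal A_2(\mathsf{state},\rho)$, $\Pr[\Delta(\mathcal M(q),\tilde y)>\delta\wedge\text{the verifier accepts }\tilde y]\le\varepsilon+\mathsf{negl}$. 2. If $\mathsf{TestTrace}$ is other-model sound with error $\varepsilon$, then so is the protocol with error $\varepsilon+\mathsf{negl}$: if the honest prover is run on $\widetilde{\mathcal M}$, then $\Pr[\Delta(\mathcal M(q),\widetilde{\mathcal M}(q))>\delta\wedge\text{the verifier accepts }\widetilde{\mathcal M}(q)]\le\varepsilon+\mathsf{negl}$. 3. If $\mathsf{TestTrace}$ is strongly other-model sound with error $\varepsilon$, then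 so is the protocol with error $\varepsilon+\mathsf{negl}$: for all efficient $(\mathcal A_1,\mathcal A_2)$ with $(\pi_1,\mathsf{state})\leftarrow\mathcal A_1(\mathsf{pp},\mathcal M,q,\widetilde{\mathcal M})$ and $\pi_2\leftarrow\mathcal A_2(\mathsf{state},\rho)$, $\Pr[\Delta(\mathcal M(q),\widetilde{\mathcal M}(q))>\delta\wedge\text{the verifier accepts }\widetilde{\mathcal M}(q)]\le\varepsilon+\mathsf{negl}$. -/

import Mathlib

/-! ## Fixed-length binary representations -/

/-- A representation of the elements of `α` by pairwise distinct bit strings of one fixed length. -/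
class BitRep (α : Type) where
  width : ℕ
  enc : α → List Bool
  length_enc : ∀ a, (enc a).length = width
  enc_injective : Function.Injective enc

/-- Bit strings of length `n`. -/
abbrev Bits (n : ℕ) : Type := Fin n → Bool

theorem flatten_ofFn_length {n w : ℕ} (f : Fin n → List Bool) (h : ∀ i, (f i).length = w) :
    (List.ofFn f).flatten.length = n * w := by
  induction n with
  | zero => simp
  | succ n ih =>
    rw [List.ofFn_succ, List.flatten_cons, List.length_append, h 0,
      ih (fun i => f i.succ) (fun i => h i.succ)]
    ring

theorem flatten_ofFn_injective {n w : ℕ} (f g : Fin n → List Bool)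
    (hf : ∀ i, (f i).length = w) (hg : ∀ i, (g i).length = w)
    (h : (List.ofFn f).flatten = (List.ofFn g).flatten) : f = g := by
  induction n with
  | zero => exact Subsingleton.elim _ _
  | succ n ih =>
    rw [List.ofFn_succ, List.ofFn_succ, List.flatten_cons, List.flatten_cons] at h
    obtain ⟨h0, h1⟩ := List.append_inj h ((hf 0).trans (hg 0).symm)
    have h2 := ih (fun i => f i.succ) (fun i => g i.succ) (fun i => hf i.succ)
      (fun i => hg i.succ) h1
    funext i
    refine Fin.cases h0 (fun j => ?_) i
    exact congrFun h2 j

instance : BitRep Unit where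
  width := 0
  enc _ := []
  length_enc _ := rfl
  enc_injective _ _ _ := rfl

instance : BitRep Bool where
  width := 1
  enc b := [b]
  length_enc _ := rfl
  enc_injective a b h := by simpa using h

/-- One-hot representation of an index. -/
instance (n : ℕ) : BitRep (Fin n) where
  width := n
  enc i := List.ofFn (fun j : Fin n => decide (j = i))
  length_enc _ := by simp
  enc_injective a b h := by
    have h1 := congrFun (List.ofFn_injective h) a
    simpa using h1

instance {α β : Type} [BitRep α] [BitRep β] : BitRep (α × β) where
  width := BitRep.width α + BitRep.width β
  enc x := BitRep.enc x.1 ++ BitRep.enc x.2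
  length_enc x := by simp [BitRep.length_enc]
  enc_injective a b h := by
    obtain ⟨h1, h2⟩ := List.append_inj h (by simp [BitRep.length_enc])
    exact Prod.ext (BitRep.enc_injective h1) (BitRep.enc_injective h2)

instance {α : Type} [BitRep α] : BitRep (Option α) where
  width := 1 + BitRep.width α
  enc x := match x with
    | none => false :: List.replicate (BitRep.width α) false
    | some a => true :: BitRep.enc a
  length_enc x := by cases x <;> simp [BitRep.length_enc, Nat.add_comm]
  enc_injective a b h := by
    cases a <;> cases b <;> simp at h ⊢
    exact BitRep.enc_injective h

instance {n : ℕ} {α : Type} [BitRep α] : BitRep (Fin n → α) where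
  width := n * BitRep.width α
  enc f := (List.ofFn (fun i => BitRep.enc (f i))).flatten
  length_enc f := flatten_ofFn_length _ (fun i => BitRep.length_enc (f i))
  enc_injective f g h := by
    have h1 := flatten_ofFn_injective _ _ (fun i => BitRep.length_enc (f i))
      (fun i => BitRep.length_enc (g i)) h
    funext i
    exact BitRep.enc_injective (congrFun h1 i)

/-- Families indexed by a set of positions, represented as partial functions on all positions. -/
instance {n : ℕ} {α : Type} [BitRep α] (s : Finset (Fin n)) : BitRep ({j // j ∈ s} → α) where
  width := BitRep.width (Fin n → Option α)
  enc f := BitRep.enc (fun j : Fin n => if h : j ∈ s then some (f ⟨j, h⟩) else none)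
  length_enc f := BitRep.length_enc _
  enc_injective f g h := by
    have h1 := BitRep.enc_injective h
    funext j
    have h2 := congrFun h1 j.1
    simpa [j.2] using h2

/-! ## Boolean circuits and efficient algorithms -/

/-- A Boolean gate of fan-in two (an arbitrary binary connective), reading two earlier wires. -/
structure Gate where
  op : Bool → Bool → Bool
  left : ℕ
  right : ℕ

/-- A Boolean circuit: wires are numbered, first the inputs, then one new wire for every gate in
order; `outs` lists the output wires. -/
structure Circuit where
  gates : List Gate
  outs : List ℕ

/-- The values of all wires, from those of the wires computed so far. -/
def evalGates : List Gate → List Bool → List Bool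
  | [], w => w
  | g :: gs, w => evalGates gs (w ++ [g.op (w.getD g.left false) (w.getD g.right false)])

def Circuit.eval (c : Circuit) (x : List Bool) : List Bool :=
  c.outs.map (fun i => (evalGates c.gates x).getD i false)

def Circuit.size (c : Circuit) : ℕ := c.gates.length + c.outs.length

/-- A family of randomized algorithms, indexed by the security parameter, is efficient if it is
computed by Boolean circuits of polynomial size (inputs, random coins, gates and outputs all
counted) whose additional inputs are independent uniform random bits. -/
def Efficient {α β : ℕ → Type} [∀ k, BitRep (α k)] [∀ k, BitRep (β k)]
    (f : ∀ k, α k → PMF (β k)) : Prop :=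
  ∃ p : Polynomial ℕ, ∀ k, ∃ (c : Circuit) (r : ℕ),
    BitRep.width (α k) + r + c.size ≤ p.eval k ∧
    ∀ x : α k, (f k x).map BitRep.enc =
      (PMF.uniformOfFintype (Bits r)).map (fun coins => c.eval (BitRep.enc x ++ List.ofFn coins))

/-- The same for deterministic algorithms. -/
def EfficientDet {α β : ℕ → Type} [∀ k, BitRep (α k)] [∀ k, BitRep (β k)]
    (f : ∀ k, α k → β k) : Prop :=
  Efficient (fun k x => PMF.pure (f k x))

/-! ## Probabilities and negligible functions -/

/-- The probability that the outcome of an experiment is a true proposition. -/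
noncomputable def Pr (experiment : PMF Prop) : ℝ := (experiment True).toReal

def Negligible (ν : ℕ → ℝ) : Prop :=
  Asymptotics.SuperpolynomialDecay Filter.atTop (fun k : ℕ => (k : ℝ)) ν

/-- `p ≤ ε + negl`. -/
def LeUpToNegl (p ε : ℕ → ℝ) : Prop :=
  ∃ ν : ℕ → ℝ, Negligible ν ∧ ∀ k, p k ≤ ε k + ν k

/-! ## Families of models -/

/-- A family of models over the alphabet `S` with outputs in `Y`. -/
structure ModelFamily (S Y : Type) where
  nModel : ℕ
  nQuery : ℕ
  nTrace : ℕ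
  nModel_pos : 0 < nModel
  nQuery_pos : 0 < nQuery
  nTrace_pos : 0 < nTrace
  evalTrace : (Fin nModel → S) → (Fin nQuery → S) → (Fin nTrace → S)
  idxsOut : Finset (Fin nTrace)
  fOut : ({j // j ∈ idxsOut} → S) → Y

namespace ModelFamily

variable {S Y : Type} (F : ModelFamily S Y)

abbrev Model : Type := Fin F.nModel → S
abbrev Query : Type := Fin F.nQuery → S
abbrev Trace : Type := Fin F.nTrace → S

/-- The output carried by an arbitrary trace. -/
def out (t : F.Trace) : Y := F.fOut (fun j => t j.1)

/-- The output of a model on a query. -/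
def run (m : F.Model) (q : F.Query) : Y := F.out (F.evalTrace m q)

end ModelFamily

/-! ## Idealized verifiable inference -/

/-- A deterministic adaptive computation with oracle access to a model string (of length `a`) and
to a trace string (of length `b`), ending in a decision. -/
inductive Probe (S : Type) (a b : ℕ) : Type where
  | decision (accept : Bool) : Probe S a b
  | readModel (j : Fin a) (next : S → Probe S a b) : Probe S a b
  | readTrace (j : Fin b) (next : S → Probe S a b) : Probe S a b

namespace Probe

variable {S : Type} {a b : ℕ}

/-- The decision when the oracles are `m` and `t`. -/
def run (m : Fin a → S) (t : Fin b → S) : Probe S a b → Bool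
  | decision d => d
  | readModel j next => run m t (next (m j))
  | readTrace j next => run m t (next (t j))

/-- The positions of the model string that the execution reads. -/
def modelReads (m : Fin a → S) (t : Fin b → S) : Probe S a b → Finset (Fin a)
  | decision _ => ∅
  | readModel j next => insert j (modelReads m t (next (m j)))
  | readTrace j next => modelReads m t (next (t j))

/-- The positions of the trace string that the execution reads. -/
def traceReads (m : Fin a → S) (t : Fin b → S) : Probe S a b → Finset (Fin b)
  | decision _ => ∅
  | readModel j next => traceReads m t (next (m j))
  | readTrace j next => insert j (traceReads m t (next (t j)))

/-- The decision when only some entries of the two strings are available: reading a missing entry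
leads to rejection. -/
def runPartial (m : Fin a → Option S) (t : Fin b → Option S) : Probe S a b → Bool
  | decision d => d
  | readModel j next =>
    match m j with
    | none => false
    | some s => runPartial m t (next s)
  | readTrace j next =>
    match t j with
    | none => false
    | some s => runPartial m t (next s)

end Probe

/-- A testing algorithm: on a query and `coins k` uniform random bits, a computation with oracle
access to model and trace. -/
structure Tester {S Y : Type} (F : ModelFamily S Y) where
  coins : ℕ → ℕ
  test : ∀ k, F.Query → Bits (coins k) → Probe S F.nModel F.nTrace

namespace Tester

variable {S Y : Type} {F : ModelFamily S Y} (T : Tester F)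

/-- The test, together with the record of the positions it reads, is efficiently executable. -/
def IsEfficient [BitRep S] : Prop :=
  EfficientDet
    (fun k (x : F.Model × F.Trace × F.Query × Bits (T.coins k)) =>
      let c := T.test k x.2.2.1 x.2.2.2
      (c.run x.1 x.2.1,
        (fun j => decide (j ∈ c.modelReads x.1 x.2.1) : Bits F.nModel),
        (fun j => decide (j ∈ c.traceReads x.1 x.2.1) : Bits F.nTrace)))

/-- The honest trace is always accepted. -/
def Correct : Prop :=
  ∀ k (m : F.Model) (q : F.Query) (ρ : Bits (T.coins k)),
    (T.test k q ρ).run m (F.evalTrace m q) = true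

noncomputable def fullGame (Dmodel : PMF F.Model) (Dquery : PMF F.Query) (Δ : Y → Y → ℝ) (δ : ℝ)
    (A : ℕ → F.Model → F.Query → PMF F.Trace) (k : ℕ) : PMF Prop := do
  let m ← Dmodel
  let q ← Dquery
  let t ← A k m q
  let ρ ← PMF.uniformOfFintype (Bits (T.coins k))
  pure (δ < Δ (F.run m q) (F.out t) ∧ (T.test k q ρ).run m t = true)

/-- Full soundness; the adversary is unbounded. -/
def FullSound (Dmodel : PMF F.Model) (Dquery : PMF F.Query) (Δ : Y → Y → ℝ) (δ : ℝ)
    (ε : ℕ → ℝ) : Prop :=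
  ∀ (A : ℕ → F.Model → F.Query → PMF F.Trace) (k : ℕ),
    Pr (T.fullGame Dmodel Dquery Δ δ A k) ≤ ε k

noncomputable def otherModelGame (Dmodel Dmodel' : PMF F.Model) (Dquery : PMF F.Query)
    (Δ : Y → Y → ℝ) (δ : ℝ) (k : ℕ) : PMF Prop := do
  let m ← Dmodel
  let m' ← Dmodel'
  let q ← Dquery
  let ρ ← PMF.uniformOfFintype (Bits (T.coins k))
  pure (δ < Δ (F.run m q) (F.run m' q) ∧ (T.test k q ρ).run m (F.evalTrace m' q) = true)

/-- Other-model soundness. -/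
def OtherModelSound (Dmodel Dmodel' : PMF F.Model) (Dquery : PMF F.Query) (Δ : Y → Y → ℝ)
    (δ : ℝ) (ε : ℕ → ℝ) : Prop :=
  ∀ k : ℕ, Pr (T.otherModelGame Dmodel Dmodel' Dquery Δ δ k) ≤ ε k

noncomputable def strongOtherModelGame (Dmodel Dmodel' : PMF F.Model) (Dquery : PMF F.Query)
    (Δ : Y → Y → ℝ) (δ : ℝ) (A : ℕ → F.Model → F.Query → F.Model → PMF F.Trace) (k : ℕ) :
    PMF Prop := do
  let m ← Dmodel
  let m' ← Dmodel'
  let q ← Dquery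
  let t ← A k m q m'
  let ρ ← PMF.uniformOfFintype (Bits (T.coins k))
  pure (δ < Δ (F.run m q) (F.run m' q) ∧ F.out t = F.run m' q ∧ (T.test k q ρ).run m t = true)

/-- Strong other-model soundness; the adversary is unbounded. -/
def StrongOtherModelSound (Dmodel Dmodel' : PMF F.Model) (Dquery : PMF F.Query) (Δ : Y → Y → ℝ)
    (δ : ℝ) (ε : ℕ → ℝ) : Prop :=
  ∀ (A : ℕ → F.Model → F.Query → F.Model → PMF F.Trace) (k : ℕ),
    Pr (T.strongOtherModelGame Dmodel Dmodel' Dquery Δ δ A k) ≤ ε k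

end Tester

/-! ## Vector commitments -/

/-- The algorithms of a vector commitment scheme over the alphabet `S`; the arguments `k` and `n`
are the security parameter and the vector length. -/
structure VectorCommitment (S : Type) where
  ppLen : ℕ → ℕ → ℕ
  cmLen : ℕ → ℕ → ℕ
  proofLen : ℕ → ℕ → ℕ
  genParams : ∀ k n, PMF (Bits (ppLen k n))
  commitVec : ∀ k n, Bits (ppLen k n) → (Fin n → S) → Bits (cmLen k n)
  openAt : ∀ k n, Bits (ppLen k n) → (Fin n → S) → Fin n → Bits (proofLen k n)
  verify : ∀ k n, Bits (ppLen k n) → Bits (cmLen k n) → Fin n → S → Bits (proofLen k n) → Bool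

namespace VectorCommitment

variable {S : Type} (V : VectorCommitment S)

/-- Honest openings are accepted. -/
def Correct (n : ℕ) : Prop :=
  ∀ k, ∀ pp ∈ (V.genParams k n).support, ∀ (v : Fin n → S) (i : Fin n),
    V.verify k n pp (V.commitVec k n pp v) i (v i) (V.openAt k n pp v i) = true

/-- All four algorithms are efficient. -/
def IsEfficient [BitRep S] (n : ℕ) : Prop :=
  Efficient (fun k (_ : Unit) => V.genParams k n) ∧
  EfficientDet (fun k (x : Bits (V.ppLen k n) × (Fin n → S)) => V.commitVec k n x.1 x.2) ∧
  EfficientDet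
    (fun k (x : Bits (V.ppLen k n) × (Fin n → S) × Fin n) => V.openAt k n x.1 x.2.1 x.2.2) ∧
  EfficientDet
    (fun k (x : Bits (V.ppLen k n) × Bits (V.cmLen k n) × Fin n × S × Bits (V.proofLen k n)) =>
      V.verify k n x.1 x.2.1 x.2.2.1 x.2.2.2.1 x.2.2.2.2)

/-- The adversary outputs a commitment, an index and two claimed values with openings. -/
noncomputable def bindingGame (n : ℕ)
    (A : ∀ k, Bits (V.ppLen k n) →
      PMF (Bits (V.cmLen k n) × Fin n × (S × Bits (V.proofLen k n)) × (S × Bits (V.proofLen k n))))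
    (k : ℕ) : PMF Prop := do
  let pp ← V.genParams k n
  let a ← A k pp
  pure (a.2.2.1.1 ≠ a.2.2.2.1 ∧
    V.verify k n pp a.1 a.2.1 a.2.2.1.1 a.2.2.1.2 = true ∧
    V.verify k n pp a.1 a.2.1 a.2.2.2.1 a.2.2.2.2 = true)

def Binding [BitRep S] (n : ℕ) : Prop :=
  ∀ A : ∀ k, Bits (V.ppLen k n) →
      PMF (Bits (V.cmLen k n) × Fin n × (S × Bits (V.proofLen k n)) × (S × Bits (V.proofLen k n))),
    Efficient A → LeUpToNegl (fun k => Pr (V.bindingGame n A k)) 0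

/-- The adversary outputs a vector, an index, a claimed value and an opening. -/
noncomputable def positionBindingGame (n : ℕ)
    (A : ∀ k, Bits (V.ppLen k n) → PMF ((Fin n → S) × Fin n × S × Bits (V.proofLen k n)))
    (k : ℕ) : PMF Prop := do
  let pp ← V.genParams k n
  let a ← A k pp
  pure (a.2.2.1 ≠ a.1 a.2.1 ∧
    V.verify k n pp (V.commitVec k n pp a.1) a.2.1 a.2.2.1 a.2.2.2 = true)

def PositionBinding [BitRep S] (n : ℕ) : Prop :=
  ∀ A : ∀ k, Bits (V.ppLen k n) → PMF ((Fin n → S) × Fin n × S × Bits (V.proofLen k n)),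
    Efficient A → LeUpToNegl (fun k => Pr (V.positionBindingGame n A k)) 0

/-- A secure vector commitment scheme. -/
def IsSecure [BitRep S] : Prop :=
  ∀ n, V.IsEfficient n ∧ V.Correct n ∧ V.Binding n ∧ V.PositionBinding n

end VectorCommitment

/-! ## Cryptographic verifiable inference -/

/-- The algorithms of a 3-round public-coin protocol for verifiable inference on a committed
model; `k` is the security parameter and `Chal k` the challenge space. -/
structure Protocol {S Y : Type} (F : ModelFamily S Y) where
  PP : ℕ → Type
  Cm : ℕ → Type
  State : ℕ → Type
  Msg₁ : ℕ → Type
  Msg₂ : ℕ → Type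
  Chal : ℕ → Type
  repPP : ∀ k, BitRep (PP k)
  repCm : ∀ k, BitRep (Cm k)
  repState : ∀ k, BitRep (State k)
  repMsg₁ : ∀ k, BitRep (Msg₁ k)
  repMsg₂ : ∀ k, BitRep (Msg₂ k)
  repChal : ∀ k, BitRep (Chal k)
  fintypeChal : ∀ k, Fintype (Chal k)
  nonemptyChal : ∀ k, Nonempty (Chal k)
  genParams : ∀ k, PMF (PP k)
  commitToModel : ∀ k, PP k → F.Model → Cm k
  prove₁ : ∀ k, PP k → F.Model → F.Query → PMF (Msg₁ k × State k)
  prove₂ : ∀ k, State k → Chal k → PMF (Msg₂ k)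
  verify : ∀ k, PP k → Cm k → F.Query → Y → Msg₁ k → Msg₂ k → Chal k → Bool

attribute [instance] Protocol.repPP Protocol.repCm Protocol.repState Protocol.repMsg₁
  Protocol.repMsg₂ Protocol.repChal Protocol.fintypeChal Protocol.nonemptyChal

namespace Protocol

variable {S Y : Type} {F : ModelFamily S Y} (P : Protocol F)

/-- All algorithms of the protocol are efficient. -/
def IsEfficient [BitRep S] [BitRep Y] : Prop :=
  Efficient (fun k (_ : Unit) => P.genParams k) ∧
  EfficientDet (fun k (x : P.PP k × F.Model) => P.commitToModel k x.1 x.2) ∧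
  Efficient (fun k (x : P.PP k × F.Model × F.Query) => P.prove₁ k x.1 x.2.1 x.2.2) ∧
  Efficient (fun k (x : P.State k × P.Chal k) => P.prove₂ k x.1 x.2) ∧
  EfficientDet
    (fun k (x : P.PP k × P.Cm k × F.Query × Y × P.Msg₁ k × P.Msg₂ k × P.Chal k) =>
      P.verify k x.1 x.2.1 x.2.2.1 x.2.2.2.1 x.2.2.2.2.1 x.2.2.2.2.2.1 x.2.2.2.2.2.2)

noncomputable def bindingGame (A : ∀ k, P.PP k → PMF (F.Model × F.Model)) (k : ℕ) :
    PMF Prop := do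
  let pp ← P.genParams k
  let a ← A k pp
  pure (a.1 ≠ a.2 ∧ P.commitToModel k pp a.1 = P.commitToModel k pp a.2)

/-- The digest binds to the model, against efficient adversaries. -/
def Binding [BitRep S] : Prop :=
  ∀ A : ∀ k, P.PP k → PMF (F.Model × F.Model),
    Efficient A → LeUpToNegl (fun k => Pr (P.bindingGame A k)) 0

noncomputable def honestGame (m : F.Model) (q : F.Query) (k : ℕ) : PMF Prop := do
  let pp ← P.genParams k
  let a ← P.prove₁ k pp m q
  let ρ ← PMF.uniformOfFintype (P.Chal k)
  let π₂ ← P.prove₂ k a.2 ρ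
  pure (P.verify k pp (P.commitToModel k pp m) q (F.run m q) a.1 π₂ ρ = true)

/-- The honest prover convinces the verifier with probability one. -/
def Correct : Prop :=
  ∀ (k : ℕ) (m : F.Model) (q : F.Query), Pr (P.honestGame m q k) = 1

noncomputable def fullGame (Dmodel : PMF F.Model) (Dquery : PMF F.Query) (Δ : Y → Y → ℝ) (δ : ℝ)
    {s : ℕ → ℕ} (A₁ : ∀ k, P.PP k × F.Model × F.Query → PMF (Y × P.Msg₁ k × Bits (s k)))
    (A₂ : ∀ k, Bits (s k) × P.Chal k → PMF (P.Msg₂ k)) (k : ℕ) : PMF Prop := do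
  let m ← Dmodel
  let pp ← P.genParams k
  let q ← Dquery
  let a ← A₁ k (pp, m, q)
  let ρ ← PMF.uniformOfFintype (P.Chal k)
  let π₂ ← A₂ k (a.2.2, ρ)
  pure (δ < Δ (F.run m q) a.1 ∧
    P.verify k pp (P.commitToModel k pp m) q a.1 a.2.1 π₂ ρ = true)

/-- Full `(ε + negl)`-soundness. The adversary is a pair of efficient algorithms that share a
state of `s k` bits. -/
def FullSoundUpToNegl [BitRep S] [BitRep Y] (Dmodel : PMF F.Model) (Dquery : PMF F.Query)
    (Δ : Y → Y → ℝ) (δ : ℝ) (ε : ℕ → ℝ) : Prop :=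
  ∀ (s : ℕ → ℕ) (A₁ : ∀ k, P.PP k × F.Model × F.Query → PMF (Y × P.Msg₁ k × Bits (s k)))
    (A₂ : ∀ k, Bits (s k) × P.Chal k → PMF (P.Msg₂ k)),
    Efficient A₁ → Efficient A₂ →
      LeUpToNegl (fun k => Pr (P.fullGame Dmodel Dquery Δ δ A₁ A₂ k)) ε

noncomputable def otherModelGame (Dmodel Dmodel' : PMF F.Model) (Dquery : PMF F.Query)
    (Δ : Y → Y → ℝ) (δ : ℝ) (k : ℕ) : PMF Prop := do
  let m ← Dmodel
  let pp ← P.genParams k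
  let m' ← Dmodel'
  let q ← Dquery
  let a ← P.prove₁ k pp m' q
  let ρ ← PMF.uniformOfFintype (P.Chal k)
  let π₂ ← P.prove₂ k a.2 ρ
  pure (δ < Δ (F.run m q) (F.run m' q) ∧
    P.verify k pp (P.commitToModel k pp m) q (F.run m' q) a.1 π₂ ρ = true)

/-- `(ε + negl)`-other-model-soundness: the prover is honest, but runs another model. -/
def OtherModelSoundUpToNegl (Dmodel Dmodel' : PMF F.Model) (Dquery : PMF F.Query)
    (Δ : Y → Y → ℝ) (δ : ℝ) (ε : ℕ → ℝ) : Prop :=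
  LeUpToNegl (fun k => Pr (P.otherModelGame Dmodel Dmodel' Dquery Δ δ k)) ε

noncomputable def strongOtherModelGame (Dmodel Dmodel' : PMF F.Model) (Dquery : PMF F.Query)
    (Δ : Y → Y → ℝ) (δ : ℝ) {s : ℕ → ℕ}
    (A₁ : ∀ k, P.PP k × F.Model × F.Query × F.Model → PMF (P.Msg₁ k × Bits (s k)))
    (A₂ : ∀ k, Bits (s k) × P.Chal k → PMF (P.Msg₂ k)) (k : ℕ) : PMF Prop := do
  let m ← Dmodel
  let pp ← P.genParams k
  let m' ← Dmodel'
  let q ← Dquery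
  let a ← A₁ k (pp, m, q, m')
  let ρ ← PMF.uniformOfFintype (P.Chal k)
  let π₂ ← A₂ k (a.2, ρ)
  pure (δ < Δ (F.run m q) (F.run m' q) ∧
    P.verify k pp (P.commitToModel k pp m) q (F.run m' q) a.1 π₂ ρ = true)

/-- Strong `(ε + negl)`-other-model-soundness. -/
def StrongOtherModelSoundUpToNegl [BitRep S] (Dmodel Dmodel' : PMF F.Model)
    (Dquery : PMF F.Query) (Δ : Y → Y → ℝ) (δ : ℝ) (ε : ℕ → ℝ) : Prop :=
  ∀ (s : ℕ → ℕ)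
    (A₁ : ∀ k, P.PP k × F.Model × F.Query × F.Model → PMF (P.Msg₁ k × Bits (s k)))
    (A₂ : ∀ k, Bits (s k) × P.Chal k → PMF (P.Msg₂ k)),
    Efficient A₁ → Efficient A₂ →
      LeUpToNegl (fun k => Pr (P.strongOtherModelGame Dmodel Dmodel' Dquery Δ δ A₁ A₂ k)) ε

end Protocol

/-! ## The compiler -/

/-- A vector of length `a`, extended to length `n` by the symbol `pad`. -/
def padTo {S : Type} (pad : S) {a : ℕ} (n : ℕ) (v : Fin a → S) : Fin n → S :=
  fun i => if h : i.1 < a then v ⟨i.1, h⟩ else pad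

namespace ModelFamily

variable {S Y : Type} (F : ModelFamily S Y)

/-- The length of the committed vectors; shorter strings are padded. -/
def commitLen : ℕ := max F.nModel F.nTrace

def modelPos (j : Fin F.nModel) : Fin F.commitLen := Fin.castLE (le_max_left _ _) j

def tracePos (j : Fin F.nTrace) : Fin F.commitLen := Fin.castLE (le_max_right _ _) j

end ModelFamily

open Classical in
/-- The compiled protocol. The last message contains, for some positions of the model and of the
trace, a value and an opening proof (`none` where nothing is provided). -/
noncomputable def compile {S Y : Type} [BitRep S] (F : ModelFamily S Y) (V : VectorCommitment S)
    (T : Tester F) (pad : S) : Protocol F where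
  PP k := Bits (V.ppLen k F.commitLen)
  Cm k := Bits (V.cmLen k F.commitLen)
  State k := Bits (V.ppLen k F.commitLen) × F.Model × F.Query × F.Trace
  Msg₁ k := Bits (V.cmLen k F.commitLen)
  Msg₂ k := (Fin F.nModel → Option (S × Bits (V.proofLen k F.commitLen))) ×
    (Fin F.nTrace → Option (S × Bits (V.proofLen k F.commitLen)))
  Chal k := Bits (T.coins k)
  repPP _ := inferInstance
  repCm _ := inferInstance
  repState _ := inferInstance
  repMsg₁ _ := inferInstance
  repMsg₂ _ := inferInstance
  repChal _ := inferInstance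
  fintypeChal _ := inferInstance
  nonemptyChal _ := inferInstance
  genParams k := V.genParams k F.commitLen
  commitToModel k pp m := V.commitVec k F.commitLen pp (padTo pad F.commitLen m)
  prove₁ k pp m q :=
    let t := F.evalTrace m q
    PMF.pure (V.commitVec k F.commitLen pp (padTo pad F.commitLen t), (pp, m, q, t))
  prove₂ k st ρ :=
    let pp := st.1
    let m := st.2.1
    let q := st.2.2.1
    let t := st.2.2.2
    let c := T.test k q ρ
    PMF.pure
      (fun j => if j ∈ c.modelReads m t then
          some (m j, V.openAt k F.commitLen pp (padTo pad F.commitLen m) (F.modelPos j))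
        else none,
       fun j => if j ∈ c.traceReads m t ∪ F.idxsOut then
          some (t j, V.openAt k F.commitLen pp (padTo pad F.commitLen t) (F.tracePos j))
        else none)
  verify k pp cm q y π₁ π₂ ρ := decide (
    (T.test k q ρ).runPartial (fun j => (π₂.1 j).map Prod.fst) (fun j => (π₂.2 j).map Prod.fst)
      = true ∧
    (∀ j a, π₂.1 j = some a → V.verify k F.commitLen pp cm (F.modelPos j) a.1 a.2 = true) ∧
    (∀ j a, π₂.2 j = some a → V.verify k F.commitLen pp π₁ (F.tracePos j) a.1 a.2 = true) ∧
    ∃ vals : {j // j ∈ F.idxsOut} → S,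
      (∀ j, (π₂.2 j.1).map Prod.fst = some (vals j)) ∧ F.fOut vals = y)

/-! ## Circuits for functions between represented types -/

/-! The soundness claims say that a commitment pins down a string. Fix models and query, which range
over finite sets. After the commitment phase, consider one position of the trace and the random
value that the prover opens there, over the choice of challenge and of the reply coins. Let `t` be
the value missed least often. If the opened value differs from `t` with probability x, then two
independent replies to the same commitment open it to different values with probability at least x².
Running the reply phase twice breaks binding with that probability, and by Jensen's inequality the
average of x is at most the square root of a negligible function (`exists_sq_le_collision`,
`IsSecure.exists_value`). Openings of the model are compared with an honest digest, so position
binding treats them directly (`IsSecure.negligible_opened_ne`). A union bound over the positions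
yields a trace that depends only on the commitment phase and agrees with all verified openings,
except with negligible probability (`IsSecure.exists_trace`).

Whenever the openings are consistent with this trace, acceptance by the verifier implies acceptance
by the ideal test (`Consistent.accepts`). The trace is fixed before the challenge, so an ideal
adversary may simulate parameters and commitment phase and output it; finding it need not be
efficient, as ideal adversaries are unbounded. The bad event is summed over the finitely many models
and queries. Hence these can be wired into the reductions, and their distributions need not be
efficiently samplable.

With an honest prover on another model the trace openings carry the true values by construction, and
only position binding is needed. Binding of the digest also reduces to position binding. Efficiency
rests on a small calculus of circuits: composition, pairing, selection of bits, and the fact that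
functions between fixed finite sets cost a constant. -/

theorem evalGates_append (gs hs : List Gate) (w : List Bool) :
    evalGates (gs ++ hs) w = evalGates hs (evalGates gs w) := by
  induction gs generalizing w with
  | nil => rfl
  | cons g gs ih => simp [evalGates, ih]

theorem length_evalGates (gs : List Gate) (w : List Bool) :
    (evalGates gs w).length = w.length + gs.length := by
  induction gs generalizing w with
  | nil => rfl
  | cons g gs ih => simp [evalGates, ih]; omega

theorem getD_evalGates (gs : List Gate) (w : List Bool) {i : ℕ} (hi : i < w.length) :
    (evalGates gs w).getD i false = w.getD i false := by
  induction gs generalizing w with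
  | nil => rfl
  | cons g gs ih =>
    rw [evalGates, ih _ (by simp; omega), List.getD_append _ _ _ _ hi]

/-- The same gate reading renumbered wires. -/
def Gate.rename (ren : ℕ → ℕ) (g : Gate) : Gate := ⟨g.op, ren g.left, ren g.right⟩

/-- The renumbering of wires when a circuit with `a` inputs is placed behind `b` wires, its
inputs being taken from the wires `ins`. -/
def splice (ins : ℕ → ℕ) (a b i : ℕ) : ℕ := if i < a then ins i else b + (i - a)

theorem getD_append_splice {ins : ℕ → ℕ} {w w' : List Bool}
    (h : ∀ i < w.length, ins i < w'.length ∧ w'.getD (ins i) false = w.getD i false)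
    (v : List Bool) (i : ℕ) :
    (w' ++ v).getD (splice ins w.length w'.length i) false = (w ++ v).getD i false := by
  unfold splice
  split_ifs with hi
  · rw [List.getD_append _ _ _ _ (h i hi).1, List.getD_append _ _ _ _ hi, (h i hi).2]
  · rw [List.getD_append_right _ _ _ _ (by omega), List.getD_append_right _ _ _ _ (by omega)]
    simp

/-- The list `v` holds the wires computed so far behind the inputs. Each renamed gate reads the same
two bits as the original and so appends the same bit to `v` on both sides. References past the last
wire stay past it and still read the default `false`. -/
theorem getD_evalGates_splice {ins : ℕ → ℕ} {w w' : List Bool}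
    (h : ∀ i < w.length, ins i < w'.length ∧ w'.getD (ins i) false = w.getD i false)
    (gs : List Gate) (v : List Bool) (i : ℕ) :
    (evalGates (gs.map (Gate.rename (splice ins w.length w'.length))) (w' ++ v)).getD
      (splice ins w.length w'.length i) false = (evalGates gs (w ++ v)).getD i false := by
  induction gs generalizing v with
  | nil => exact getD_append_splice h v i
  | cons g gs ih =>
    simp only [List.map_cons, evalGates, Gate.rename, getD_append_splice h, List.append_assoc]
    exact ih _

/-- The function `f` is computed by a Boolean circuit with at most `N` gates. -/
def CktLe {α β : Type} [BitRep α] [BitRep β] (N : ℕ) (f : α → β) : Prop :=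
  ∃ c : Circuit, c.gates.length ≤ N ∧
    (∀ i ∈ c.outs, i < BitRep.width α + c.gates.length) ∧
    ∀ x, c.eval (BitRep.enc x) = BitRep.enc (f x)

/-- The bit number `i` of the representation. -/
def BitRep.bit {α : Type} [BitRep α] (i : ℕ) (x : α) : Bool := (BitRep.enc x).getD i false

theorem BitRep.enc_eq_map_bit {α : Type} [BitRep α] (x : α) :
    BitRep.enc x = (List.range (BitRep.width α)).map (fun i => BitRep.bit i x) := by
  apply List.ext_getElem
  · simp [BitRep.length_enc]
  · intro i h1 h2
    simp [BitRep.bit, List.getElem?_eq_getElem h1]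

theorem BitRep.bit_injective {α : Type} [BitRep α] {x y : α}
    (h : ∀ i < BitRep.width α, BitRep.bit i x = BitRep.bit i y) : x = y := by
  apply BitRep.enc_injective
  rw [BitRep.enc_eq_map_bit, BitRep.enc_eq_map_bit]
  exact List.map_congr_left fun i hi => h i (List.mem_range.1 hi)

theorem BitRep.enc_bits {n : ℕ} (b : Bits n) : BitRep.enc b = List.ofFn b := by
  change (List.ofFn (fun i => [b i])).flatten = List.ofFn b
  induction n with
  | zero => simp
  | succ n ih => rw [List.ofFn_succ, List.flatten_cons, List.ofFn_succ, ih (fun i => b i.succ)]; rfl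

theorem BitRep.width_bits (n : ℕ) : BitRep.width (Bits n) = n := Nat.mul_one n

namespace CktLe

variable {α β γ : Type} [BitRep α] [BitRep β] [BitRep γ]

theorem mono {M N : ℕ} {f : α → β} (h : CktLe M f) (hMN : M ≤ N) : CktLe N f := by
  obtain ⟨c, h1, h2⟩ := h
  exact ⟨c, h1.trans hMN, h2⟩

theorem recode {N : ℕ} {f : α → β} (h : CktLe N f) {g : α → γ}
    (hg : ∀ x, BitRep.enc (g x) = BitRep.enc (f x)) : CktLe N g := by
  obtain ⟨c, h1, h2, h3⟩ := h
  exact ⟨c, h1, h2, fun x => by rw [hg, h3]⟩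

/-- Functions whose output bits are copies of input bits. -/
theorem of_select {f : α → β} (I : List ℕ) (hI : ∀ i ∈ I, i < BitRep.width α)
    (h : ∀ x, BitRep.enc (f x) = I.map (fun i => BitRep.bit i x)) : CktLe 0 f :=
  ⟨⟨[], I⟩, le_rfl, by simpa using hI, fun x => by rw [h]; rfl⟩

theorem bit {i : ℕ} (hi : i < BitRep.width α) : CktLe 0 (BitRep.bit i : α → Bool) :=
  of_select [i] (by simpa using hi) fun _ => rfl

theorem id : CktLe 0 (fun x : α => x) :=
  of_select (List.range (BitRep.width α)) (by simp) BitRep.enc_eq_map_bit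

theorem fst : CktLe 0 (Prod.fst : α × β → α) := by
  refine of_select (List.range (BitRep.width α)) ?_ ?_
  · intro i hi
    exact (List.mem_range.1 hi).trans_le (Nat.le_add_right _ _)
  · intro x
    rw [BitRep.enc_eq_map_bit]
    refine List.map_congr_left fun i hi => (List.getD_append _ _ _ _ ?_).symm
    rw [BitRep.length_enc]
    exact List.mem_range.1 hi

theorem snd : CktLe 0 (Prod.snd : α × β → β) := by
  refine of_select ((List.range (BitRep.width β)).map (BitRep.width α + ·)) ?_ ?_
  · intro i hi
    obtain ⟨j, hj, rfl⟩ := List.mem_map.1 hi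
    exact Nat.add_lt_add_left (List.mem_range.1 hj) _
  · intro x
    rw [BitRep.enc_eq_map_bit, List.map_map]
    refine List.map_congr_left fun i hi => ?_
    change _ = (BitRep.enc x.1 ++ BitRep.enc x.2).getD _ _
    rw [List.getD_append_right _ _ _ _ (by rw [BitRep.length_enc]; exact Nat.le_add_right _ _),
      BitRep.length_enc]
    simp [BitRep.bit]

theorem comp {M N : ℕ} {g : β → γ} {f : α → β} (hg : CktLe N g) (hf : CktLe M f) :
    CktLe (M + N) (fun x => g (f x)) := by
  obtain ⟨c, hc1, hc2, hc3⟩ := hf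
  obtain ⟨d, hd1, hd2, hd3⟩ := hg
  -- That the first circuit has exactly `BitRep.width β` outputs is visible only on an actual input;
  -- without inputs the empty circuit serves.
  by_cases hne : Nonempty α
  swap
  · exact ⟨⟨[], []⟩, by simp, by simp, fun x => (hne ⟨x⟩).elim⟩
  have hlen : c.outs.length = BitRep.width β := by
    obtain ⟨x⟩ := hne
    have := congrArg List.length (hc3 x)
    simpa [Circuit.eval, BitRep.length_enc] using this
  set s := splice (fun i => c.outs.getD i 0) (BitRep.width β) (BitRep.width α + c.gates.length)
    with hs
  refine ⟨⟨c.gates ++ d.gates.map (Gate.rename s), d.outs.map s⟩, ?_, ?_, fun x => ?_⟩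
  · simp; omega
  · intro i hi
    obtain ⟨j, hj, rfl⟩ := List.mem_map.1 hi
    have := hd2 j hj
    simp only [hs, splice, List.length_append, List.length_map]
    split_ifs with h
    · have h' : j < c.outs.length := by omega
      rw [List.getD_eq_getElem _ _ h']
      have := hc2 _ (List.getElem_mem h')
      omega
    · omega
  · rw [← hd3, ← hc3]
    simp only [Circuit.eval, List.map_map]
    refine List.map_congr_left fun i hi => ?_
    simp only [Function.comp, evalGates_append]
    have key := getD_evalGates_splice (ins := fun i => c.outs.getD i 0)
      (w := c.eval (BitRep.enc x)) (w' := evalGates c.gates (BitRep.enc x)) (fun i hi => by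
        have h' : i < c.outs.length := by simpa [Circuit.eval] using hi
        have := hc2 _ (List.getElem_mem h')
        simp only [List.getD_eq_getElem _ _ h', length_evalGates, BitRep.length_enc]
        refine ⟨this, ?_⟩
        rw [List.getD_eq_getElem _ _ hi]
        simp [Circuit.eval]) d.gates [] i
    rw [show (c.eval (BitRep.enc x)).length = BitRep.width β by rw [hc3, BitRep.length_enc],
      length_evalGates, BitRep.length_enc, ← hs, List.append_nil, List.append_nil] at key
    exact key

theorem prodMk {M N : ℕ} {f : α → β} {g : α → γ} (hf : CktLe M f) (hg : CktLe N g) :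
    CktLe (M + N) (fun x => (f x, g x)) := by
  obtain ⟨c, hc1, hc2, hc3⟩ := hf
  obtain ⟨d, hd1, hd2, hd3⟩ := hg
  set s := splice (fun i => i) (BitRep.width α) (BitRep.width α + c.gates.length) with hs
  refine ⟨⟨c.gates ++ d.gates.map (Gate.rename s), c.outs ++ d.outs.map s⟩, ?_, ?_, fun x => ?_⟩
  · simp; omega
  · intro i hi
    simp only [List.length_append, List.length_map]
    rcases List.mem_append.1 hi with hi | hi
    · have := hc2 i hi
      omega
    · obtain ⟨j, hj, rfl⟩ := List.mem_map.1 hi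
      have := hd2 j hj
      simp only [hs, splice]
      split_ifs <;> omega
  · change _ = BitRep.enc (f x) ++ BitRep.enc (g x)
    rw [← hd3, ← hc3]
    simp only [Circuit.eval, List.map_map, List.map_append]
    congr 1
    · refine List.map_congr_left fun i hi => ?_
      rw [evalGates_append, getD_evalGates]
      rw [length_evalGates, BitRep.length_enc]
      exact hc2 i hi
    · refine List.map_congr_left fun i hi => ?_
      simp only [Function.comp, evalGates_append]
      have key := getD_evalGates_splice (ins := fun i => i)
        (w := BitRep.enc x) (w' := evalGates c.gates (BitRep.enc x)) (fun i hi => by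
          refine ⟨?_, getD_evalGates _ _ hi⟩
          rw [length_evalGates]
          omega) d.gates [] i
      rw [length_evalGates, BitRep.length_enc, ← hs, List.append_nil, List.append_nil] at key
      exact key

/-- A single gate. -/
theorem gate (op : Bool → Bool → Bool) : CktLe 1 (fun x : Bool × Bool => op x.1 x.2) := by
  refine ⟨⟨[⟨op, 0, 1⟩], [2]⟩, le_rfl, ?_, ?_⟩
  · intro i hi
    obtain rfl : i = 2 := by simpa using hi
    exact Nat.lt_succ_self 2
  · rintro ⟨a, b⟩
    rfl

theorem gate₂ (op : Bool → Bool → Bool) {M N : ℕ} {f g : α → Bool} (hf : CktLe M f)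
    (hg : CktLe N g) : CktLe (M + N + 1) (fun x => op (f x) (g x)) :=
  (gate op).comp (hf.prodMk hg)

theorem constBool (b : Bool) : CktLe 1 (fun _ : α => b) := by
  refine ⟨⟨[⟨fun _ _ => b, 0, 0⟩], [BitRep.width α]⟩, le_rfl, by simp, fun x => ?_⟩
  simp only [Circuit.eval, evalGates, List.map_cons, List.map_nil]
  rw [List.getD_append_right _ _ _ _ (by rw [BitRep.length_enc]), BitRep.length_enc]
  simp
  rfl

theorem pi {n N : ℕ} {f : Fin n → α → β} (h : ∀ i, CktLe N (f i)) :
    CktLe (n * N) (fun x i => f i x) := by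
  induction n with
  | zero =>
    refine (of_select [] (by simp) fun x => ?_).mono (Nat.zero_le _)
    rw [List.map_nil, ← List.length_eq_zero_iff, BitRep.length_enc]
    exact Nat.zero_mul _
  | succ n ih =>
    refine (((h 0).prodMk (ih fun i => h i.succ)).mono (by ring_nf; rfl)).recode fun x => ?_
    change (List.ofFn fun i => BitRep.enc (f i x)).flatten = _
    rw [List.ofFn_succ, List.flatten_cons]
    rfl

/-- A function is computed bit by bit. -/
theorem of_bits {N : ℕ} {f : α → β}
    (h : ∀ i < BitRep.width β, CktLe N (fun x => BitRep.bit i (f x))) :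
    CktLe (BitRep.width β * N) f := by
  refine (pi (f := fun (i : Fin (BitRep.width β)) x => BitRep.bit i (f x))
    fun i => h i i.2).recode fun x => ?_
  rw [BitRep.enc_bits (fun i : Fin (BitRep.width β) => BitRep.bit i (f x)), BitRep.enc_eq_map_bit]
  apply List.ext_getElem <;> simp

theorem const (b : β) : CktLe (BitRep.width β) (fun _ : α => b) :=
  (of_bits (N := 1) fun _ _ => constBool _).mono (Nat.mul_one _).le

theorem bit_pi {n : ℕ} (f : Fin n → β) (i : Fin n) {b : ℕ} (hb : b < BitRep.width β) :
    BitRep.bit (i * BitRep.width β + b) f = BitRep.bit b (f i) := by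
  change (List.ofFn fun i => BitRep.enc (f i)).flatten.getD _ _ = _
  induction n with
  | zero => exact i.elim0
  | succ n ih =>
    rw [List.ofFn_succ, List.flatten_cons]
    refine Fin.cases ?_ (fun j => ?_) i
    · rw [List.getD_append _ _ _ _ (by rw [BitRep.length_enc]; simpa using hb)]
      simp [BitRep.bit]
    · have e : (j.succ : ℕ) * BitRep.width β + b = BitRep.width β + (j * BitRep.width β + b) := by
        rw [Fin.val_succ]; ring
      rw [e, List.getD_append_right _ _ _ _ (by rw [BitRep.length_enc]; omega),
        BitRep.length_enc, Nat.add_sub_cancel_left]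
      exact ih (fun i => f i.succ) j

theorem apply {n : ℕ} (i : Fin n) : CktLe 0 (fun f : Fin n → β => f i) := by
  refine of_select ((List.range (BitRep.width β)).map (i * BitRep.width β + ·)) ?_ ?_
  · intro b hb
    obtain ⟨j, hj, rfl⟩ := List.mem_map.1 hb
    have hj := List.mem_range.1 hj
    calc i * BitRep.width β + j < i * BitRep.width β + BitRep.width β := by omega
      _ = (i + 1) * BitRep.width β := by ring
      _ ≤ n * BitRep.width β := Nat.mul_le_mul_right _ i.2
  · intro f
    rw [BitRep.enc_eq_map_bit, List.map_map]
    exact List.map_congr_left fun b hb => (bit_pi f i (List.mem_range.1 hb)).symm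

/-- Every Boolean function of `w` bits is computed by a circuit whose size depends on `w` only. -/
theorem exists_bits (w : ℕ) : ∃ C, ∀ h : Bits w → Bool, CktLe C h := by
  induction w with
  | zero =>
    refine ⟨1, fun h => ?_⟩
    have : h = fun _ => h Fin.elim0 := funext fun x => congrArg h (Subsingleton.elim _ _)
    rw [this]
    exact constBool _
  | succ w ih =>
    obtain ⟨C, hC⟩ := ih
    refine ⟨2 * C + 3, fun h => ?_⟩
    have htail : CktLe 0 (fun (x : Bits (w + 1)) (i : Fin w) => x i.succ) :=
      (pi (f := fun (i : Fin w) (x : Bits (w + 1)) => x i.succ) fun i => apply i.succ).mono (by simp)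
    have hd : CktLe 0 (fun x : Bits (w + 1) => x 0) := apply 0
    -- Shannon expansion along the first bit: two circuits for the restrictions of `h`, one gate on
    -- each to select it, and one gate to join them, hence `2 * C + 3`.
    have h1 := gate₂ (fun a b => a && b) hd ((hC fun x => h (Fin.cons true x)).comp htail)
    have h0 := gate₂ (fun a b => !a && b) hd ((hC fun x => h (Fin.cons false x)).comp htail)
    have := (gate₂ (fun a b => a || b) h1 h0).mono (N := 2 * C + 3) (by omega)
    convert this using 2 with x
    have hx : x = Fin.cons (x 0) (fun i => x i.succ) := (Fin.cons_self_tail x).symm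
    conv_lhs => rw [hx]
    cases x 0 <;> simp

variable (α β) in
/-- All functions between two represented types have circuits of bounded size. -/
theorem exists_forall : ∃ C, ∀ f : α → β, CktLe C f := by
  obtain ⟨C, hC⟩ := exists_bits (BitRep.width α)
  refine ⟨BitRep.width β * C, fun f => of_bits fun i _ => ?_⟩
  let e : α → Bits (BitRep.width α) := fun x j => BitRep.bit j x
  have he : CktLe 0 e :=
    (pi (f := fun (j : Fin (BitRep.width α)) (x : α) => BitRep.bit j x)
      fun j => bit j.2).mono (by simp)
  have hinj : Function.Injective e := fun x y hxy =>
    BitRep.bit_injective fun j hj => congrFun hxy ⟨j, hj⟩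
  -- An output bit is a function of the code of the input; bit strings that are not codes are sent
  -- to `false`.
  have := (hC (Function.extend e (fun x => BitRep.bit i (f x)) fun _ => false)).comp he
  refine (this.mono (by omega)).recode fun x => ?_
  rw [hinj.extend_apply]

theorem bit_option_zero (o : Option β) : BitRep.bit 0 o = o.isSome := by
  cases o <;> rfl

theorem bit_option_none (i : ℕ) : BitRep.bit i (none : Option β) = false := by
  change (List.replicate (BitRep.width β + 1) false).getD i false = false
  simp [List.getElem?_replicate]
  split_ifs <;> rfl

/-- A value is passed on if a condition holds. -/
theorem guard : CktLe ((1 + BitRep.width β) * 1)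
    (fun x : Bool × β => if x.1 then some x.2 else none) := by
  refine of_bits fun i hi => ?_
  have hw : BitRep.width (Bool × β) = 1 + BitRep.width β := rfl
  have hi' : i < 1 + BitRep.width β := hi
  -- The codes of `(true, y)` and `some y` coincide, and that of `none` is all zeros; so every
  -- output bit is the input bit masked by bit 0.
  refine (gate₂ (fun a b => a && b) (bit (α := Bool × β) (i := 0) (by omega))
    (bit (α := Bool × β) (i := i) (by omega))).recode fun x => congrArg BitRep.enc ?_
  obtain ⟨b, y⟩ := x
  cases b
  · exact (bit_option_none i)
  · rfl

/-- A default value is supplied. -/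
theorem getD (d : β) : CktLe (BitRep.width β * 1) (fun o : Option β => o.getD d) := by
  refine of_bits fun i hi => ?_
  have hw : BitRep.width (Option β) = 1 + BitRep.width β := rfl
  -- Bit 0 of an option tells whether a value is present, which shifts the bits of the value by one;
  -- the bits of `d` are built into the gates.
  refine (gate₂ (fun a b => bif a then b else BitRep.bit i d)
    (bit (α := Option β) (i := 0) (by omega))
    (bit (α := Option β) (i := i + 1) (by omega))).recode fun o => congrArg BitRep.enc ?_
  cases o
  · rw [bit_option_zero]; rfl
  · rw [bit_option_zero]; rfl

theorem isSome : CktLe 0 (fun o : Option β => o.isSome) :=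
  (bit (α := Option β) (i := 0) (by change 0 < 1 + _; omega)).recode
    fun o => by rw [bit_option_zero]

end CktLe

/-! ## Polynomial-size families -/

/-- A function bounded by a polynomial. -/
def PolyBdd (g : ℕ → ℕ) : Prop := ∃ p : Polynomial ℕ, ∀ k, g k ≤ p.eval k

namespace PolyBdd

variable {g h : ℕ → ℕ}

theorem mono (hg : PolyBdd g) (hle : ∀ k, h k ≤ g k) : PolyBdd h :=
  hg.imp fun _ hp k => (hle k).trans (hp k)

theorem add (hg : PolyBdd g) (hh : PolyBdd h) : PolyBdd (fun k => g k + h k) := by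
  obtain ⟨p, hp⟩ := hg
  obtain ⟨q, hq⟩ := hh
  exact ⟨p + q, fun k => by simpa using Nat.add_le_add (hp k) (hq k)⟩

theorem mul (hg : PolyBdd g) (hh : PolyBdd h) : PolyBdd (fun k => g k * h k) := by
  obtain ⟨p, hp⟩ := hg
  obtain ⟨q, hq⟩ := hh
  exact ⟨p * q, fun k => by simpa using Nat.mul_le_mul (hp k) (hq k)⟩

theorem const (c : ℕ) : PolyBdd (fun _ => c) := ⟨Polynomial.C c, fun k => by simp⟩

end PolyBdd

/-- The lengths of the representations grow polynomially. -/
def PolyWidth (α : ℕ → Type) [∀ k, BitRep (α k)] : Prop := PolyBdd fun k => BitRep.width (α k)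

/-- The functions `f k` have circuits of polynomial size. -/
def PolyDet {α β : ℕ → Type} [∀ k, BitRep (α k)] [∀ k, BitRep (β k)]
    (f : ∀ k, α k → β k) : Prop :=
  ∃ N : ℕ → ℕ, PolyBdd N ∧ ∀ k, CktLe (N k) (f k)

namespace PolyWidth

variable {α β : ℕ → Type} [∀ k, BitRep (α k)] [∀ k, BitRep (β k)]

theorem const (α : Type) [BitRep α] : PolyWidth (fun _ => α) := PolyBdd.const _

theorem prod (hα : PolyWidth α) (hβ : PolyWidth β) : PolyWidth (fun k => α k × β k) :=
  PolyBdd.add hα hβ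

theorem fst (h : PolyWidth (fun k => α k × β k)) : PolyWidth α :=
  PolyBdd.mono h fun _ => Nat.le_add_right _ _

theorem snd (h : PolyWidth (fun k => α k × β k)) : PolyWidth β :=
  PolyBdd.mono h fun _ => Nat.le_add_left _ _

theorem option (h : PolyWidth α) : PolyWidth (fun k => Option (α k)) :=
  PolyBdd.add (PolyBdd.const 1) h

theorem pi (n : ℕ) (h : PolyWidth α) : PolyWidth (fun k => Fin n → α k) :=
  PolyBdd.mul (PolyBdd.const n) h

theorem bits {r : ℕ → ℕ} (h : PolyBdd r) : PolyWidth (fun k => Bits (r k)) :=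
  PolyBdd.mono h fun _ => (BitRep.width_bits _).le

theorem polyBdd_of_bits {r : ℕ → ℕ} (h : PolyWidth (fun k => Bits (r k))) : PolyBdd r :=
  PolyBdd.mono h fun _ => (BitRep.width_bits _).ge

end PolyWidth

namespace PolyDet

variable {α β γ : ℕ → Type} [∀ k, BitRep (α k)] [∀ k, BitRep (β k)] [∀ k, BitRep (γ k)]

theorem of_zero {f : ∀ k, α k → β k} (h : ∀ k, CktLe 0 (f k)) : PolyDet f :=
  ⟨fun _ => 0, PolyBdd.const 0, h⟩

theorem id : PolyDet (fun k (x : α k) => x) := of_zero fun _ => CktLe.id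

theorem comp {g : ∀ k, β k → γ k} {f : ∀ k, α k → β k} (hg : PolyDet g) (hf : PolyDet f) :
    PolyDet (fun k x => g k (f k x)) := by
  obtain ⟨M, hM, hf⟩ := hf
  obtain ⟨N, hN, hg⟩ := hg
  exact ⟨_, hM.add hN, fun k => (hg k).comp (hf k)⟩

theorem fst {f : ∀ k, α k → β k × γ k} (hf : PolyDet f) : PolyDet (fun k x => (f k x).1) :=
  comp (of_zero fun _ => CktLe.fst) hf

theorem snd {f : ∀ k, α k → β k × γ k} (hf : PolyDet f) : PolyDet (fun k x => (f k x).2) :=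
  comp (of_zero fun _ => CktLe.snd) hf

theorem prodMk {f : ∀ k, α k → β k} {g : ∀ k, α k → γ k} (hf : PolyDet f) (hg : PolyDet g) :
    PolyDet (fun k x => (f k x, g k x)) := by
  obtain ⟨M, hM, hf⟩ := hf
  obtain ⟨N, hN, hg⟩ := hg
  exact ⟨_, hM.add hN, fun k => (hf k).prodMk (hg k)⟩

theorem pi {n : ℕ} {f : Fin n → ∀ k, α k → β k} (h : ∀ i, PolyDet (f i)) :
    PolyDet (fun k x i => f i k x) := by
  choose N hN hf using h
  refine ⟨fun k => n * ∑ i, N i k, PolyBdd.mul (PolyBdd.const n) ?_, fun k => CktLe.pi fun i =>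
    (hf i k).mono (Finset.single_le_sum (f := fun i => N i k) (fun _ _ => Nat.zero_le _)
      (Finset.mem_univ i))⟩
  have : ∀ s : Finset (Fin n), PolyBdd fun k => ∑ i ∈ s, N i k := by
    intro s
    induction s using Finset.induction_on with
    | empty => simpa using PolyBdd.const 0
    | insert a s ha ih => simpa [Finset.sum_insert ha] using (hN a).add ih
  exact this _

theorem apply {n : ℕ} {f : ∀ k, α k → Fin n → β k} (hf : PolyDet f) (i : Fin n) :
    PolyDet (fun k x => f k x i) :=
  comp (g := fun k (f : Fin n → β k) => f i) (of_zero fun _ => CktLe.apply i) hf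

theorem const (hβ : PolyWidth β) (b : ∀ k, β k) : PolyDet (fun k (_ : α k) => b k) :=
  ⟨_, hβ, fun k => CktLe.const (b k)⟩

/-- Functions between fixed finite sets, which may depend on the security parameter. -/
theorem finite {A B : Type} [BitRep A] [BitRep B] {f : ∀ k, α k → A} (hf : PolyDet f)
    (g : ℕ → A → B) : PolyDet (fun k x => g k (f k x)) := by
  -- One constant serves all functions from `A` to `B`, so the dependence of `g` on the security
  -- parameter is harmless.
  obtain ⟨C, hC⟩ := CktLe.exists_forall A B
  exact comp (g := g) ⟨_, PolyBdd.const C, fun k => hC _⟩ hf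

theorem guard (hβ : PolyWidth β) {c : ∀ k, α k → Bool} {f : ∀ k, α k → β k} (hc : PolyDet c)
    (hf : PolyDet f) : PolyDet (fun k x => if c k x then some (f k x) else none) :=
  comp (g := fun k (x : Bool × β k) => if x.1 then some x.2 else none)
    ⟨_, ((PolyBdd.const 1).add hβ).mul (PolyBdd.const 1), fun _ => CktLe.guard⟩ (prodMk hc hf)

theorem getD (hβ : PolyWidth β) {f : ∀ k, α k → Option (β k)} (hf : PolyDet f) (d : ∀ k, β k) :
    PolyDet (fun k x => (f k x).getD (d k)) :=
  comp (g := fun k (x : Option (β k)) => x.getD (d k))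
    ⟨_, PolyBdd.mul hβ (PolyBdd.const 1), fun k => CktLe.getD (d k)⟩ hf

theorem isSome {f : ∀ k, α k → Option (β k)} (hf : PolyDet f) :
    PolyDet (fun k x => (f k x).isSome) :=
  comp (g := fun k (x : Option (β k)) => x.isSome) (of_zero fun _ => CktLe.isSome) hf

end PolyDet

/-! ## Randomized families -/

theorem PMF.map_injective_of_injective {A B : Type*} {e : A → B} (he : Function.Injective e) :
    Function.Injective (PMF.map e) := by
  intro p q h
  ext a
  have key : ∀ p : PMF A, p.map e (e a) = p a := fun p => by
    rw [PMF.map_apply, tsum_eq_single a fun b hb => if_neg fun h => hb (he h).symm]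
    simp
  rw [← key p, ← key q, h]

/-- Uniform elements of a product are pairs of independent uniform elements. -/
theorem PMF.uniformOfFintype_eq_bind {A B C : Type*} [Fintype A] [Fintype B] [Fintype C]
    [Nonempty A] [Nonempty B] [Nonempty C] (e : A × B ≃ C) :
    PMF.uniformOfFintype C = (PMF.uniformOfFintype A).bind fun a =>
      (PMF.uniformOfFintype B).map fun b => e (a, b) := by
  classical
  ext c
  obtain ⟨⟨a, b⟩, rfl⟩ := e.surjective c
  rw [PMF.bind_apply, tsum_eq_single a]
  · rw [PMF.map_apply, tsum_eq_single b]
    · simp only [if_true, PMF.uniformOfFintype_apply]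
      rw [← Fintype.card_congr e, Fintype.card_prod, Nat.cast_mul,
        ENNReal.mul_inv (by simp) (by simp)]
    · intro b' hb
      exact if_neg fun h => hb (by simpa using (e.injective h).symm)
  · intro a' ha
    rw [PMF.map_apply, ENNReal.tsum_eq_zero.2, mul_zero]
    intro b'
    exact if_neg fun h => ha (congrArg Prod.fst (e.injective h)).symm

/-- Randomized algorithms given by functions of polynomial circuit size of the input and of
polynomially many coins. -/
def PolyRand {α β : ℕ → Type} [∀ k, BitRep (α k)] [∀ k, BitRep (β k)]
    (f : ∀ k, α k → PMF (β k)) : Prop :=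
  ∃ (r : ℕ → ℕ) (g : ∀ k, α k × Bits (r k) → β k), PolyBdd r ∧ PolyDet g ∧
    ∀ k x, f k x = (PMF.uniformOfFintype (Bits (r k))).map fun ω => g k (x, ω)

/-- Missing output wires may be replaced by a constant gate. -/
theorem Circuit.exists_outs_lt (c : Circuit) (n : ℕ) : ∃ d : Circuit,
    d.gates.length = c.gates.length + 1 ∧ (∀ i ∈ d.outs, i < n + d.gates.length) ∧
    ∀ x : List Bool, x.length = n → d.eval x = c.eval x := by
  -- Outputs beyond the last wire read `false`, but would pick up foreign gates once the circuit is
  -- composed; they are redirected to a final gate that is constantly `false`.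
  refine ⟨⟨c.gates ++ [⟨fun _ _ => false, 0, 0⟩],
    c.outs.map fun i => min i (n + c.gates.length)⟩, by simp, ?_, ?_⟩
  · intro i hi
    obtain ⟨j, -, rfl⟩ := List.mem_map.1 hi
    simp only [List.length_append, List.length_cons, List.length_nil]
    omega
  · intro x hx
    simp only [Circuit.eval, List.map_map]
    refine List.map_congr_left fun i _ => ?_
    simp only [Function.comp, evalGates_append, evalGates]
    have hl : (evalGates c.gates x).length = n + c.gates.length := by rw [length_evalGates, hx]
    rcases lt_or_ge i (n + c.gates.length) with h | h
    · rw [min_eq_left h.le, List.getD_append _ _ _ _ (by omega)]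
    · rw [min_eq_right h, List.getD_append_right _ _ _ _ (by omega),
        List.getD_eq_default (evalGates c.gates x) _ (by omega), hl]
      simp

section

variable {α β γ : ℕ → Type} [∀ k, BitRep (α k)] [∀ k, BitRep (β k)] [∀ k, BitRep (γ k)]

theorem Efficient.polyRand {f : ∀ k, α k → PMF (β k)} (h : Efficient f) : PolyRand f := by
  obtain ⟨p, hp⟩ := h
  choose c r hsize hf using hp
  -- On a valid input every coin string leads to the code of some element, because the circuit
  -- output lies in the support of a distribution of codes. Decoding it defines `g`.
  have hex : ∀ k (x : α k × Bits (r k)), ∃ y : β k,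
      BitRep.enc y = (c k).eval (BitRep.enc x.1 ++ List.ofFn x.2) := by
    intro k x
    have : (c k).eval (BitRep.enc x.1 ++ List.ofFn x.2) ∈ ((f k x.1).map BitRep.enc).support := by
      rw [hf, PMF.support_map]
      exact ⟨x.2, by simp, rfl⟩
    rw [PMF.support_map] at this
    obtain ⟨y, -, hy⟩ := this
    exact ⟨y, hy⟩
  choose g hg using hex
  refine ⟨r, g, ⟨p, fun k => ?_⟩, ⟨fun k => p.eval k + 1, ?_, fun k => ?_⟩, fun k x => ?_⟩
  · have := hsize k
    omega
  · exact PolyBdd.add ⟨p, fun _ => le_rfl⟩ (PolyBdd.const 1)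
  · obtain ⟨d, hd1, hd2, hd3⟩ := (c k).exists_outs_lt (BitRep.width (α k × Bits (r k)))
    refine ⟨d, ?_, hd2, fun x => ?_⟩
    · have := hsize k
      simp only [Circuit.size] at this
      dsimp only
      omega
    · rw [hd3 _ (BitRep.length_enc x), hg, ← BitRep.enc_bits]
      rfl
  · apply PMF.map_injective_of_injective BitRep.enc_injective
    rw [hf, PMF.map_comp]
    congr 1
    funext ω
    exact (hg k (x, ω)).symm

theorem PolyRand.efficient {f : ∀ k, α k → PMF (β k)} (hα : PolyWidth α) (hβ : PolyWidth β)
    (h : PolyRand f) : Efficient f := by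
  obtain ⟨r, g, hr, ⟨N, hN, hg⟩, hf⟩ := h
  obtain ⟨p, hp⟩ := (PolyBdd.add hα hr).add (hN.add hβ)
  refine ⟨p, fun k => ?_⟩
  -- The number of output wires, which counts towards the size, is known to be `BitRep.width (β k)`
  -- only if there is an input.
  by_cases hne : Nonempty (α k)
  · obtain ⟨c, hc1, -, hc3⟩ := hg k
    refine ⟨c, r k, le_trans (Nat.add_le_add_left ?_ _) (hp k), fun x => ?_⟩
    · refine Nat.add_le_add hc1 ?_
      obtain ⟨x⟩ := hne
      have := congrArg List.length (hc3 (x, fun _ => false))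
      rw [BitRep.length_enc, Circuit.eval, List.length_map] at this
      exact this.le
    · rw [hf, PMF.map_comp]
      congr 1
      funext ω
      rw [← BitRep.enc_bits]
      exact (hc3 (x, ω)).symm
  · refine ⟨⟨[], []⟩, 0, le_trans ?_ (hp k), fun x => (hne ⟨x⟩).elim⟩
    simp only [Circuit.size, List.length_nil]
    omega

theorem PolyDet.polyRand {f : ∀ k, α k → β k} (h : PolyDet f) :
    PolyRand (fun k x => PMF.pure (f k x)) :=
  ⟨fun _ => 0, fun k x => f k x.1, PolyBdd.const 0, h.comp PolyDet.id.fst, fun k x => by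
    exact (PMF.map_const _ _).symm⟩

theorem PolyDet.efficientDet {f : ∀ k, α k → β k} (hα : PolyWidth α) (hβ : PolyWidth β)
    (h : PolyDet f) : EfficientDet f :=
  h.polyRand.efficient hα hβ

/-- Since the output distribution is a point mass, every coin string gives the right answer; the
coins may be fixed to zeros. -/
theorem EfficientDet.polyDet {f : ∀ k, α k → β k} (h : EfficientDet f) : PolyDet f := by
  obtain ⟨r, g, hr, hg, hf⟩ := h.polyRand
  have : f = fun k x => g k (x, fun _ => false) := by
    funext k x
    have : g k (x, fun _ => false) ∈ (PMF.pure (f k x)).support := by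
      rw [show PMF.pure (f k x) = _ from hf k x, PMF.support_map]
      exact ⟨_, by simp, rfl⟩
    exact ((PMF.mem_support_pure_iff _ _).1 this).symm
  rw [this]
  exact hg.comp (PolyDet.id.prodMk (PolyDet.const (PolyWidth.bits hr) fun _ _ => false))

/-- The size in `Efficient` includes the input length. All polynomial bounds on parameters,
commitments, proofs and test coins are obtained in this way from the efficiency of an algorithm that
reads them. -/
theorem Efficient.polyWidth_left {f : ∀ k, α k → PMF (β k)} (h : Efficient f) : PolyWidth α := by
  obtain ⟨p, hp⟩ := h
  refine ⟨p, fun k => ?_⟩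
  obtain ⟨c, r, h, -⟩ := hp k
  dsimp only
  omega

theorem PolyRand.comp {g : ∀ k, β k → PMF (γ k)} {f : ∀ k, α k → β k} (hg : PolyRand g)
    (hf : PolyDet f) : PolyRand (fun k x => g k (f k x)) := by
  obtain ⟨r, h, hr, hh, e⟩ := hg
  exact ⟨r, fun k x => h k (f k x.1, x.2), hr,
    hh.comp ((hf.comp PolyDet.id.fst).prodMk PolyDet.id.snd), fun k x => e k _⟩

theorem PolyRand.bind {f : ∀ k, α k → PMF (β k)} {g : ∀ k, α k × β k → PMF (γ k)}
    (hf : PolyRand f) (hg : PolyRand g) :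
    PolyRand (fun k x => (f k x).bind fun y => g k (x, y)) := by
  obtain ⟨r, u, hr, hu, ef⟩ := hf
  obtain ⟨s, v, hs, hv, eg⟩ := hg
  -- The coin string is cut into two independent parts, one for each phase.
  refine ⟨fun k => r k + s k, fun k x => v k ((x.1, u k (x.1, fun i => x.2 (Fin.castAdd _ i))),
    fun i => x.2 (Fin.natAdd _ i)), hr.add hs, ?_, fun k x => ?_⟩
  · have hl : PolyDet (fun k (x : α k × Bits (r k + s k)) (i : Fin (r k)) =>
        x.2 (Fin.castAdd _ i)) :=
      ⟨_, hr.mul (PolyBdd.const 0), fun k => CktLe.pi fun i => (CktLe.apply (Fin.castAdd _ i)).comp CktLe.snd⟩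
    have hr : PolyDet (fun k (x : α k × Bits (r k + s k)) (i : Fin (s k)) =>
        x.2 (Fin.natAdd _ i)) :=
      ⟨_, hs.mul (PolyBdd.const 0), fun k => CktLe.pi fun i => (CktLe.apply (Fin.natAdd _ i)).comp CktLe.snd⟩
    exact hv.comp ((PolyDet.id.fst.prodMk (hu.comp (PolyDet.id.fst.prodMk hl))).prodMk hr)
  · dsimp only
    rw [PMF.uniformOfFintype_eq_bind (Fin.appendEquiv (r k) (s k)), PMF.map_bind, ef,
      PMF.bind_map]
    congr 1
    funext ω
    simp only [Function.comp, eg, PMF.map_comp]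
    congr 1
    funext ω'
    simp [Fin.appendEquiv]

theorem PolyRand.uniform {r : ℕ → ℕ} (hr : PolyBdd r) :
    PolyRand (fun k (_ : α k) => PMF.uniformOfFintype (Bits (r k))) :=
  ⟨r, fun _ x => x.2, hr, PolyDet.id.snd, fun _ _ => (PMF.map_id _).symm⟩

end

/-! ## Expectations over finite probability spaces -/

/-- The expectation of a real function. -/
noncomputable def expect {α : Type} [Fintype α] (p : PMF α) (φ : α → ℝ) : ℝ :=
  ∑ a, (p a).toReal * φ a

open Classical in
/-- The truth value of a proposition as a number. -/
noncomputable def ind (P : Prop) : ℝ := if P then 1 else 0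

theorem ind_nonneg (P : Prop) : 0 ≤ ind P := by
  unfold ind; split_ifs <;> norm_num

theorem ind_of_true {P : Prop} (h : P) : ind P = 1 := if_pos h

theorem ind_of_not {P : Prop} (h : ¬ P) : ind P = 0 := if_neg h

theorem ind_mono {P Q : Prop} (h : P → Q) : ind P ≤ ind Q := by
  by_cases hP : P
  · rw [ind_of_true hP, ind_of_true (h hP)]
  · rw [ind_of_not hP]; exact ind_nonneg Q

theorem ind_le_add {P Q R : Prop} (h : P → Q ∨ R) : ind P ≤ ind Q + ind R := by
  by_cases hP : P
  · rcases h hP with hQ | hR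
    · rw [ind_of_true hP, ind_of_true hQ]; linarith [ind_nonneg R]
    · rw [ind_of_true hP, ind_of_true hR]; linarith [ind_nonneg Q]
  · rw [ind_of_not hP]; linarith [ind_nonneg Q, ind_nonneg R]

theorem ind_exists_le {ι : Type} [Fintype ι] (P : ι → Prop) :
    ind (∃ i, P i) ≤ ∑ i, ind (P i) := by
  by_cases h : ∃ i, P i
  · obtain ⟨i, hi⟩ := h
    rw [ind_of_true ⟨i, hi⟩, ← ind_of_true hi]
    exact Finset.single_le_sum (f := fun i => ind (P i)) (fun _ _ => ind_nonneg _)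
      (Finset.mem_univ i)
  · rw [ind_of_not h]
    exact Finset.sum_nonneg fun _ _ => ind_nonneg _

theorem Pr_pure (P : Prop) : Pr (pure P) = ind P := by
  change ((PMF.pure P) True).toReal = _
  rw [PMF.pure_apply]
  by_cases h : P
  · simp [ind, h]
  · simp [ind, h]

section Expect

variable {α β : Type} [Fintype α] [Fintype β] (p : PMF α)

theorem PMF.sum_toReal : ∑ a, (p a).toReal = 1 := by
  have h := p.tsum_coe
  rw [tsum_fintype] at h
  rw [← ENNReal.toReal_sum fun a _ => p.apply_ne_top a, h, ENNReal.toReal_one]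

theorem Pr_bind (f : α → PMF Prop) : Pr (p >>= f) = expect p fun a => Pr (f a) := by
  change ((p.bind f) True).toReal = _
  rw [PMF.bind_apply, tsum_fintype, ENNReal.toReal_sum]
  · simp [expect, Pr, ENNReal.toReal_mul]
  · exact fun a _ => ENNReal.mul_ne_top (p.apply_ne_top a) ((f a).apply_ne_top True)

theorem expect_bind (f : α → PMF β) (φ : β → ℝ) :
    expect (p.bind f) φ = expect p fun a => expect (f a) φ := by
  have h : ∀ b, ((p.bind f) b).toReal = ∑ a, (p a).toReal * (f a b).toReal := fun b => by
    rw [PMF.bind_apply, tsum_fintype, ENNReal.toReal_sum]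
    · simp [ENNReal.toReal_mul]
    · exact fun a _ => ENNReal.mul_ne_top (p.apply_ne_top a) ((f a).apply_ne_top b)
  simp only [expect, h, Finset.sum_mul, Finset.mul_sum, mul_assoc]
  exact Finset.sum_comm

/-- Unfolds a game one binder at a time. The `Fintype` argument is found by unification with the
right-hand side, because the types of the compiled protocol reveal their finiteness only after
unfolding. -/
theorem Pr_bind_eq {α : Type} {_ : Fintype α} (p : PMF α) {f : α → PMF Prop} {φ : α → ℝ}
    (h : ∀ a, Pr (f a) = φ a) :
    Pr (p >>= f) = expect p φ := by
  rw [Pr_bind]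
  exact congrArg _ (funext h)

theorem expect_pure (a : α) (φ : α → ℝ) : expect (PMF.pure a) φ = φ a := by
  classical
  rw [expect, Finset.sum_eq_single a]
  · simp
  · intro b _ hb
    simp [PMF.pure_apply, hb]
  · simp

theorem expect_const (c : ℝ) : expect p (fun _ => c) = c := by
  rw [expect, ← Finset.sum_mul, p.sum_toReal, one_mul]

variable {p}

theorem expect_mono_support {φ ψ : α → ℝ} (h : ∀ a ∈ p.support, φ a ≤ ψ a) :
    expect p φ ≤ expect p ψ := by
  refine Finset.sum_le_sum fun a _ => ?_
  by_cases ha : a ∈ p.support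
  · exact mul_le_mul_of_nonneg_left (h a ha) ENNReal.toReal_nonneg
  · rw [PMF.mem_support_iff, not_not] at ha
    simp [ha]

theorem expect_mono {φ ψ : α → ℝ} (h : ∀ a, φ a ≤ ψ a) : expect p φ ≤ expect p ψ :=
  expect_mono_support fun a _ => h a

theorem expect_congr_support {φ ψ : α → ℝ} (h : ∀ a ∈ p.support, φ a = ψ a) :
    expect p φ = expect p ψ :=
  le_antisymm (expect_mono_support fun a ha => (h a ha).le)
    (expect_mono_support fun a ha => (h a ha).ge)

theorem expect_nonneg {φ : α → ℝ} (h : ∀ a, 0 ≤ φ a) : 0 ≤ expect p φ :=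
  Finset.sum_nonneg fun a _ => mul_nonneg ENNReal.toReal_nonneg (h a)

theorem Pr_nonneg (e : PMF Prop) : 0 ≤ Pr e := ENNReal.toReal_nonneg

variable (p)

theorem expect_add (φ ψ : α → ℝ) :
    expect p (fun a => φ a + ψ a) = expect p φ + expect p ψ := by
  simp only [expect, mul_add, Finset.sum_add_distrib]

theorem expect_mul_right (c : ℝ) (φ : α → ℝ) : expect p (fun a => φ a * c) = expect p φ * c := by
  simp only [expect, Finset.sum_mul, mul_assoc]

theorem expect_sum {ι : Type} (s : Finset ι) (φ : ι → α → ℝ) :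
    expect p (fun a => ∑ i ∈ s, φ i a) = ∑ i ∈ s, expect p (φ i) := by
  simp only [expect, Finset.mul_sum]
  exact Finset.sum_comm

theorem expect_comm (q : PMF β) (φ : α → β → ℝ) :
    expect p (fun a => expect q (φ a)) = expect q fun b => expect p fun a => φ a b := by
  simp only [expect, Finset.mul_sum]
  rw [Finset.sum_comm]
  exact Finset.sum_congr rfl fun b _ => Finset.sum_congr rfl fun a _ => by ring

/-- Since point probabilities are at most one, an average over models or queries can be replaced by
a finite sum, whose terms are negligible one by one. -/
theorem expect_le_sum {φ : α → ℝ} (h : ∀ a, 0 ≤ φ a) : expect p φ ≤ ∑ a, φ a := by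
  refine Finset.sum_le_sum fun a _ => mul_le_of_le_one_left (h a) ?_
  exact ENNReal.toReal_le_of_le_ofReal zero_le_one (by simpa using p.coe_le_one a)

theorem expect_sq_le {φ : α → ℝ} (h : ∀ a, 0 ≤ φ a) :
    expect p φ ^ 2 ≤ expect p fun a => φ a ^ 2 :=
  Real.pow_arith_mean_le_arith_mean_pow Finset.univ (fun a => (p a).toReal) φ
    (fun _ _ => ENNReal.toReal_nonneg) p.sum_toReal (fun a _ => h a) 2

/-- If two independent samples rarely carry different values, then some value is rarely missed. -/
theorem exists_sq_le_collision {S : Type} [Finite S] [Nonempty S] (v : α → Option S) :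
    ∃ t : S, expect p (fun x => ind (∃ s, v x = some s ∧ s ≠ t)) ^ 2 ≤
      expect p fun x => expect p fun x' => ind (∃ s s', v x = some s ∧ v x' = some s' ∧ s ≠ s') := by
  let φ : S → ℝ := fun t => expect p fun x => ind (∃ s, v x = some s ∧ s ≠ t)
  -- The value that is missed least often.
  obtain ⟨t, ht⟩ := Finite.exists_min φ
  have h0 : 0 ≤ φ t := expect_nonneg fun _ => ind_nonneg _
  refine ⟨t, ?_⟩
  calc φ t ^ 2 = φ t * φ t := sq _
    _ ≤ expect p (fun x => ind (∃ s, v x = some s)) * φ t := by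
      refine mul_le_mul_of_nonneg_right (expect_mono fun x => ind_mono ?_) h0
      exact fun ⟨s, hs, _⟩ => ⟨s, hs⟩
    _ = expect p fun x => ind (∃ s, v x = some s) * φ t := (expect_mul_right _ _ _).symm
    _ ≤ _ := by
      refine expect_mono fun x => ?_
      by_cases hx : ∃ s, v x = some s
      · obtain ⟨s, hs⟩ := hx
        rw [ind_of_true ⟨s, hs⟩, one_mul]
        -- Once the first sample shows `s`, the second shows a value other than `s` with probability
        -- `φ s`, which is at least `φ t`.
        refine (ht s).trans (expect_mono fun x' => ind_mono ?_)
        rintro ⟨s', h', hne⟩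
        exact ⟨s, s', hs, h', hne.symm⟩
      · rw [ind_of_not hx, zero_mul]
        exact expect_nonneg fun _ => ind_nonneg _

end Expect

/-! ## Negligible functions -/

namespace Negligible

variable {μ ν : ℕ → ℝ}

theorem add (hμ : Negligible μ) (hν : Negligible ν) : Negligible (fun k => μ k + ν k) :=
  Asymptotics.SuperpolynomialDecay.add hμ hν

theorem zero : Negligible (fun _ => 0) := Asymptotics.superpolynomialDecay_zero _ _

theorem sum {ι : Type} (s : Finset ι) {ν : ι → ℕ → ℝ} (h : ∀ i, Negligible (ν i)) :
    Negligible (fun k => ∑ i ∈ s, ν i k) := by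
  classical
  induction s using Finset.induction_on with
  | empty => simpa using zero
  | insert a s ha ih => simpa [Finset.sum_insert ha] using (h a).add ih

theorem of_le (hν : Negligible ν) (h0 : ∀ k, 0 ≤ μ k) (h : ∀ k, μ k ≤ ν k) : Negligible μ :=
  Asymptotics.SuperpolynomialDecay.trans_abs_le hν fun k => by
    rw [abs_of_nonneg (h0 k)]
    exact (h k).trans (le_abs_self _)

/-- For every n, the product of k^n and √ν equals √(k^(2n) ν), which tends to zero. -/
theorem sqrt (hν : Negligible ν) : Negligible (fun k => Real.sqrt (ν k)) := by
  intro n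
  have h := (hν (2 * n)).sqrt
  rw [Real.sqrt_zero] at h
  refine h.congr fun k => ?_
  rw [Real.sqrt_mul (by positivity), mul_comm 2 n, pow_mul, Real.sqrt_sq (by positivity)]

theorem of_leUpToNegl (h0 : ∀ k, 0 ≤ μ k) (h : LeUpToNegl μ 0) : Negligible μ := by
  obtain ⟨ν, hν, h⟩ := h
  exact hν.of_le h0 fun k => by simpa using h k

theorem leUpToNegl {ε : ℕ → ℝ} (hν : Negligible ν) (h : ∀ k, μ k ≤ ε k + ν k) :
    LeUpToNegl μ ε := ⟨ν, hν, h⟩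

end Negligible

/-- A type with a fixed-length representation is finite. -/
theorem BitRep.finite (α : Type) [BitRep α] : Finite α := by
  refine Finite.of_injective (fun (x : α) (i : Fin (BitRep.width α)) => BitRep.bit i x) ?_
  exact fun x y h => BitRep.bit_injective fun i hi => congrFun h ⟨i, hi⟩

/-! ## Probes on partially known strings -/

namespace Probe

variable {S : Type} {a b : ℕ}

/-- A missing entry causes rejection, so an accepting partial run reads only known entries, all of
them correct, and follows the path of the full run. -/
theorem run_of_runPartial {m : Fin a → S} {t : Fin b → S} {m' : Fin a → Option S}
    {t' : Fin b → Option S} (hm : ∀ j s, m' j = some s → s = m j)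
    (ht : ∀ j s, t' j = some s → s = t j) (c : Probe S a b)
    (h : c.runPartial m' t' = true) : c.run m t = true := by
  induction c with
  | decision d => exact h
  | readModel j next ih =>
    simp only [runPartial] at h
    split at h
    · cases h
    · next s hs =>
      obtain rfl := hm j s hs
      exact ih _ h
  | readTrace j next ih =>
    simp only [runPartial] at h
    split at h
    · cases h
    · next s hs =>
      obtain rfl := ht j s hs
      exact ih _ h

theorem runPartial_of_reads {m : Fin a → S} {t : Fin b → S} {m' : Fin a → Option S}
    {t' : Fin b → Option S} (c : Probe S a b)
    (hm : ∀ j ∈ c.modelReads m t, m' j = some (m j))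
    (ht : ∀ j ∈ c.traceReads m t, t' j = some (t j)) : c.runPartial m' t' = c.run m t := by
  induction c with
  | decision d => rfl
  | readModel j next ih =>
    simp only [runPartial, hm j (Finset.mem_insert_self _ _)]
    exact ih _ (fun i hi => hm i (Finset.mem_insert_of_mem hi)) ht
  | readTrace j next ih =>
    simp only [runPartial, ht j (Finset.mem_insert_self _ _)]
    exact ih _ hm (fun i hi => ht i (Finset.mem_insert_of_mem hi))

/-- Running on partial strings is running on arbitrary extensions, provided that only known
entries are read. -/
theorem runPartial_eq_true_iff (pad : S) (m : Fin a → Option S) (t : Fin b → Option S)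
    (c : Probe S a b) : c.runPartial m t = true ↔
      c.run (fun j => (m j).getD pad) (fun j => (t j).getD pad) = true ∧
      (∀ j ∈ c.modelReads (fun j => (m j).getD pad) (fun j => (t j).getD pad),
        (m j).isSome = true) ∧
      (∀ j ∈ c.traceReads (fun j => (m j).getD pad) (fun j => (t j).getD pad),
        (t j).isSome = true) := by
  induction c with
  | decision d => simp [runPartial, run, modelReads, traceReads]
  | readModel j next ih =>
    cases h : m j with
    | none => simp [runPartial, modelReads, h]
    | some s => simp [runPartial, run, modelReads, traceReads, h, ih]
  | readTrace j next ih =>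
    cases h : t j with
    | none => simp [runPartial, traceReads, h]
    | some s => simp [runPartial, run, modelReads, traceReads, h, ih]

end Probe

/-! ## Reductions to the binding properties -/

namespace VectorCommitment

variable {S : Type} (V : VectorCommitment S)

/-- The value to which a claimed opening verifies. -/
def opened (k n : ℕ) (pp : Bits (V.ppLen k n)) (cm : Bits (V.cmLen k n)) (i : Fin n)
    (o : Option (S × Bits (V.proofLen k n))) : Option S :=
  o.bind fun x => if V.verify k n pp cm i x.1 x.2 = true then some x.1 else none

theorem opened_eq_some {k n : ℕ} {pp : Bits (V.ppLen k n)} {cm : Bits (V.cmLen k n)} {i : Fin n}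
    {o : Option (S × Bits (V.proofLen k n))} {s : S} (h : V.opened k n pp cm i o = some s) :
    ∃ π, o = some (s, π) ∧ V.verify k n pp cm i s π = true := by
  obtain ⟨⟨s', π⟩, rfl, h'⟩ := Option.bind_eq_some_iff.1 h
  split_ifs at h' with hv
  obtain rfl := Option.some.inj h'
  exact ⟨π, rfl, hv⟩

variable {V} [BitRep S] {n : ℕ}

theorem IsSecure.polyWidth_pp (hV : V.IsSecure) (n : ℕ) :
    PolyWidth (fun k => Bits (V.ppLen k n)) :=
  PolyWidth.fst (Efficient.polyWidth_left (hV n).1.2.1)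

theorem IsSecure.polyWidth_cm (hV : V.IsSecure) (n : ℕ) :
    PolyWidth (fun k => Bits (V.cmLen k n)) :=
  PolyWidth.fst (PolyWidth.snd (Efficient.polyWidth_left (hV n).1.2.2.2))

theorem IsSecure.polyWidth_proof (hV : V.IsSecure) (n : ℕ) :
    PolyWidth (fun k => Bits (V.proofLen k n)) :=
  PolyWidth.snd (PolyWidth.snd (PolyWidth.snd (PolyWidth.snd
    (Efficient.polyWidth_left (hV n).1.2.2.2))))

variable [Fintype S] {Γ : ℕ → Type} [∀ k, BitRep (Γ k)] [∀ k, Fintype (Γ k)]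

/-- If a commitment made by an efficient adversary is opened at a fixed position by an efficient
randomized algorithm, then the value opened is all but determined by the commitment phase. -/
theorem IsSecure.exists_value (hV : V.IsSecure) (pad : S)
    {A : ∀ k, Bits (V.ppLen k n) → PMF (Γ k)} (hA : PolyRand A)
    {com : ∀ k, Γ k → Bits (V.cmLen k n)} (hcom : PolyDet com)
    {W : ∀ k, Γ k → PMF (Option (S × Bits (V.proofLen k n)))} (hW : PolyRand W) (i : Fin n) :
    ∃ t : ∀ k, Bits (V.ppLen k n) → Γ k → S,
      Negligible fun k => expect (V.genParams k n) fun pp => expect (A k pp) fun a =>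
        expect (W k a) fun o => ind (∃ s, V.opened k n pp (com k a) i o = some s ∧ s ≠ t k pp a) := by
  have : Nonempty S := ⟨pad⟩
  -- These values are merely shown to exist; no algorithm computes them.
  choose t ht using fun k (pp : Bits (V.ppLen k n)) (a : Γ k) =>
    exists_sq_le_collision (W k a) (V.opened k n pp (com k a) i)
  refine ⟨t, ?_⟩
  let d : ∀ k, S × Bits (V.proofLen k n) := fun k => (pad, fun _ => false)
  have hw : PolyWidth (fun k => S × Bits (V.proofLen k n)) :=
    (PolyWidth.const S).prod (hV.polyWidth_proof n)
  -- The binding adversary: commit once, reply twice from the same state with fresh coins, and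
  -- output both openings of position `i`.
  let B : ∀ k, Bits (V.ppLen k n) → PMF (Bits (V.cmLen k n) × Fin n ×
      (S × Bits (V.proofLen k n)) × (S × Bits (V.proofLen k n))) := fun k pp =>
    (A k pp).bind fun a => (W k a).bind fun o => (W k a).bind fun o' =>
      PMF.pure (com k a, i, o.getD (d k), o'.getD (d k))
  have hB : PolyRand B := by
    refine PolyRand.bind hA (g := fun k x => (W k x.2).bind fun o => (W k x.2).bind fun o' =>
      PMF.pure (com k x.2, i, o.getD (d k), o'.getD (d k))) ?_
    refine PolyRand.bind (f := fun k (x : Bits (V.ppLen k n) × Γ k) => W k x.2)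
      (hW.comp PolyDet.id.snd) (g := fun k x => (W k x.1.2).bind fun o' =>
      PMF.pure (com k x.1.2, i, x.2.getD (d k), o'.getD (d k))) ?_
    refine PolyRand.bind (f := fun k (x : (Bits (V.ppLen k n) × Γ k) ×
      Option (S × Bits (V.proofLen k n))) => W k x.1.2) (hW.comp PolyDet.id.fst.snd) (g := fun k x =>
      PMF.pure (com k x.1.1.2, i, x.1.2.getD (d k), x.2.getD (d k))) ?_
    exact ((hcom.comp PolyDet.id.fst.fst.snd).prodMk ((PolyDet.const (PolyWidth.const _) _).prodMk
      ((PolyDet.id.fst.snd.getD hw d).prodMk (PolyDet.id.snd.getD hw d)))).polyRand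
  have hneg := Negligible.of_leUpToNegl (fun _ => Pr_nonneg _)
    ((hV n).2.2.1 B (hB.efficient (hV.polyWidth_pp n)
      ((hV.polyWidth_cm n).prod ((PolyWidth.const _).prod (hw.prod hw)))))
  -- It suffices to bound the square of the average. Jensen's inequality moves the square inside
  -- twice, past the parameters and past the commitment phase, to where the collision bound `ht`
  -- applies.
  refine hneg.sqrt.of_le (fun k => expect_nonneg fun _ => expect_nonneg fun _ =>
    expect_nonneg fun _ => ind_nonneg _) fun k => Real.le_sqrt_of_sq_le ?_
  refine (expect_sq_le _ fun _ => expect_nonneg fun _ => expect_nonneg fun _ =>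
    ind_nonneg _).trans ?_
  rw [bindingGame, Pr_bind]
  refine expect_mono fun pp => ?_
  rw [Pr_bind, expect_bind]
  refine (expect_sq_le _ fun _ => expect_nonneg fun _ => ind_nonneg _).trans ?_
  refine expect_mono fun a => (ht k pp a).trans ?_
  simp only [expect_bind, expect_pure, Pr_pure]
  refine expect_mono fun o => expect_mono fun o' => ind_mono ?_
  rintro ⟨s, s', h, h', hne⟩
  obtain ⟨π, rfl, hπ⟩ := V.opened_eq_some h
  obtain ⟨π', rfl, hπ'⟩ := V.opened_eq_some h'
  exact ⟨hne, hπ, hπ'⟩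

/-- Commitments to a fixed vector are opened to other values with negligible probability only. -/
theorem IsSecure.negligible_opened_ne (hV : V.IsSecure) (pad : S)
    {A : ∀ k, Bits (V.ppLen k n) → PMF (Γ k)} (hA : PolyRand A)
    {W : ∀ k, Γ k → PMF (Option (S × Bits (V.proofLen k n)))} (hW : PolyRand W)
    (v : Fin n → S) (i : Fin n) :
    Negligible fun k => expect (V.genParams k n) fun pp => expect (A k pp) fun a =>
      expect (W k a) fun o =>
        ind (∃ s, V.opened k n pp (V.commitVec k n pp v) i o = some s ∧ s ≠ v i) := by
  let d : ∀ k, S × Bits (V.proofLen k n) := fun k => (pad, fun _ => false)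
  have hw : PolyWidth (fun k => S × Bits (V.proofLen k n)) :=
    (PolyWidth.const S).prod (hV.polyWidth_proof n)
  let B : ∀ k, Bits (V.ppLen k n) → PMF ((Fin n → S) × Fin n × S × Bits (V.proofLen k n)) :=
    fun k pp => (A k pp).bind fun a => (W k a).bind fun o => PMF.pure (v, i, o.getD (d k))
  have hB : PolyRand B := by
    refine PolyRand.bind hA (g := fun k x => (W k x.2).bind fun o =>
      PMF.pure (v, i, o.getD (d k))) ?_
    refine PolyRand.bind (f := fun k (x : Bits (V.ppLen k n) × Γ k) => W k x.2)
      (hW.comp PolyDet.id.snd) (g := fun k x =>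
      PMF.pure (v, i, x.2.getD (d k))) ?_
    exact ((PolyDet.const (PolyWidth.const _) _).prodMk ((PolyDet.const (PolyWidth.const _) _).prodMk
      (PolyDet.id.snd.getD hw d))).polyRand
  have hneg := Negligible.of_leUpToNegl (fun _ => Pr_nonneg _)
    ((hV n).2.2.2 B (hB.efficient (hV.polyWidth_pp n)
      ((PolyWidth.const _).prod ((PolyWidth.const _).prod hw))))
  refine hneg.of_le (fun k => expect_nonneg fun _ => expect_nonneg fun _ =>
    expect_nonneg fun _ => ind_nonneg _) fun k => ?_
  rw [positionBindingGame, Pr_bind]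
  refine expect_mono fun pp => ?_
  rw [Pr_bind, expect_bind]
  simp only [expect_bind, expect_pure, Pr_pure]
  refine expect_mono fun a => expect_mono fun o => ind_mono ?_
  rintro ⟨s, h, hne⟩
  obtain ⟨π, rfl, hπ⟩ := V.opened_eq_some h
  exact ⟨hne, hπ⟩

end VectorCommitment

/-! ## Acceptance in the compiled protocol -/

theorem padTo_modelPos {S Y : Type} (F : ModelFamily S Y) (pad : S) (m : F.Model)
    (j : Fin F.nModel) : padTo pad F.commitLen m (F.modelPos j) = m j :=
  dif_pos j.2

theorem padTo_tracePos {S Y : Type} (F : ModelFamily S Y) (pad : S) (t : F.Trace)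
    (j : Fin F.nTrace) : padTo pad F.commitLen t (F.tracePos j) = t j :=
  dif_pos j.2

theorem opened_of_map_fst {S : Type} {V : VectorCommitment S} {k n : ℕ} {pp : Bits (V.ppLen k n)}
    {cm : Bits (V.cmLen k n)} {i : Fin n}
    {o : Option (S × Bits (V.proofLen k n))} {s : S}
    (hv : ∀ a, o = some a → V.verify k n pp cm i a.1 a.2 = true)
    (h : o.map Prod.fst = some s) : V.opened k n pp cm i o = some s := by
  obtain ⟨a, rfl, rfl⟩ := Option.map_eq_some_iff.1 h
  simp [VectorCommitment.opened, hv a rfl]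

section Compile

variable {S Y : Type} [BitRep S] {F : ModelFamily S Y} {V : VectorCommitment S}
  {T : Tester F} {pad : S}

variable (F V) in
/-- The last message of the compiled protocol. -/
abbrev Reply (k : ℕ) : Type :=
  (Fin F.nModel → Option (S × Bits (V.proofLen k F.commitLen))) ×
    (Fin F.nTrace → Option (S × Bits (V.proofLen k F.commitLen)))

/-- The opened values that verify are those of the model `m` and of the trace `t`. -/
def Consistent {k : ℕ} (pad : S) (pp : Bits (V.ppLen k F.commitLen)) (m : F.Model) (t : F.Trace)
    (π₁ : Bits (V.cmLen k F.commitLen)) (π₂ : Reply F V k) : Prop :=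
  (∀ j s, V.opened k F.commitLen pp (V.commitVec k F.commitLen pp (padTo pad F.commitLen m))
    (F.modelPos j) (π₂.1 j) = some s → s = m j) ∧
  ∀ j s, V.opened k F.commitLen pp π₁ (F.tracePos j) (π₂.2 j) = some s → s = t j

theorem compile_verify_iff {k : ℕ} {pp : Bits (V.ppLen k F.commitLen)}
    {cm : Bits (V.cmLen k F.commitLen)} {q : F.Query} {y : Y} {π₁ : Bits (V.cmLen k F.commitLen)}
    {π₂ : Reply F V k} {ρ : Bits (T.coins k)} :
    (compile F V T pad).verify k pp cm q y π₁ π₂ ρ = true ↔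
    ((T.test k q ρ).runPartial (fun j => (π₂.1 j).map Prod.fst) (fun j => (π₂.2 j).map Prod.fst)
      = true ∧
    (∀ j a, π₂.1 j = some a → V.verify k F.commitLen pp cm (F.modelPos j) a.1 a.2 = true) ∧
    (∀ j a, π₂.2 j = some a → V.verify k F.commitLen pp π₁ (F.tracePos j) a.1 a.2 = true) ∧
    ∃ vals : {j // j ∈ F.idxsOut} → S,
      (∀ j, (π₂.2 j.1).map Prod.fst = some (vals j)) ∧ F.fOut vals = y) := by
  simp only [compile, decide_eq_true_eq]

/-- Acceptance of consistent openings means acceptance by the ideal test. -/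
theorem Consistent.accepts {k : ℕ} {pp : Bits (V.ppLen k F.commitLen)} {m : F.Model} {q : F.Query}
    {y : Y} {t : F.Trace} {π₁ : Bits (V.cmLen k F.commitLen)} {π₂ : Reply F V k}
    {ρ : Bits (T.coins k)} (hc : Consistent pad pp m t π₁ π₂)
    (h : (compile F V T pad).verify k pp ((compile F V T pad).commitToModel k pp m) q y π₁ π₂ ρ
      = true) : F.out t = y ∧ (T.test k q ρ).run m t = true := by
  obtain ⟨hrun, hm, ht, vals, hvals, rfl⟩ := compile_verify_iff.1 h
  refine ⟨congrArg F.fOut (funext fun j => ?_), ?_⟩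
  · exact (hc.2 _ _ (opened_of_map_fst (ht j.1) (hvals j))).symm
  · exact Probe.run_of_runPartial
      (fun j s hs => hc.1 j s (opened_of_map_fst (hm j) hs))
      (fun j s hs => hc.2 j s (opened_of_map_fst (ht j) hs)) _ hrun

/-! ## Security of the compiled protocol -/

/-- A reduction draws the challenge itself. Challenge and answer thus form one randomized reply,
which can be run twice from the same state. -/
theorem compile_reply_polyRand (hρ : PolyBdd T.coins) {s : ℕ → ℕ}
    {A₂ : ∀ k, Bits (s k) × Bits (T.coins k) → PMF (Reply F V k)} (hA₂ : PolyRand A₂)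
    {Γ : ℕ → Type} [∀ k, BitRep (Γ k)] {st : ∀ k, Γ k → Bits (s k)} (hst : PolyDet st) :
    PolyRand fun k a => (PMF.uniformOfFintype (Bits (T.coins k))).bind fun ρ =>
      A₂ k (st k a, ρ) :=
  (PolyRand.uniform hρ).bind (g := fun k x => A₂ k (st k x.1, x.2))
    (hA₂.comp ((hst.comp PolyDet.id.fst).prodMk PolyDet.id.snd))

variable [Fintype S]

/-- Against an efficient prover, a trace can be extracted from the commitment phase with which,
together with the model, all openings are consistent up to negligible probability. -/
theorem VectorCommitment.IsSecure.exists_trace (hV : V.IsSecure) (pad : S) {Γ : ℕ → Type}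
    [∀ k, BitRep (Γ k)] [∀ k, Fintype (Γ k)]
    {A : ∀ k, Bits (V.ppLen k F.commitLen) → PMF (Γ k)} (hA : PolyRand A)
    {com : ∀ k, Γ k → Bits (V.cmLen k F.commitLen)} (hcom : PolyDet com)
    {R : ∀ k, Γ k → PMF (Reply F V k)} (hR : PolyRand R) (m : F.Model) :
    ∃ t : ∀ k, Bits (V.ppLen k F.commitLen) → Γ k → F.Trace,
      Negligible fun k => expect (V.genParams k F.commitLen) fun pp => expect (A k pp) fun a =>
        expect (R k a) fun π₂ => ind (¬ Consistent pad pp m (t k pp a) (com k a) π₂) := by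
  have hM : ∀ j, PolyRand fun k a => (R k a).bind fun π₂ => PMF.pure (π₂.1 j) := fun j =>
    hR.bind (g := fun k x => PMF.pure (x.2.1 j)) (PolyDet.id.snd.fst.apply j).polyRand
  have hT : ∀ j, PolyRand fun k a => (R k a).bind fun π₂ => PMF.pure (π₂.2 j) := fun j =>
    hR.bind (g := fun k x => PMF.pure (x.2.2 j)) (PolyDet.id.snd.snd.apply j).polyRand
  -- The digest of `m` is honest, so the correct value is known in advance and position binding
  -- applies. The trace commitment is the adversary's own, so its values have to be extracted.
  have hm := fun j => hV.negligible_opened_ne pad hA (hM j) (padTo pad F.commitLen m) (F.modelPos j)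
  choose t ht using fun j => hV.exists_value pad hA hcom (hT j) (F.tracePos j)
  refine ⟨fun k pp a j => t j k pp a, ((Negligible.sum Finset.univ hm).add
    (Negligible.sum Finset.univ ht)).of_le (fun k => expect_nonneg fun _ => expect_nonneg fun _ =>
    expect_nonneg fun _ => ind_nonneg _) fun k => ?_⟩
  simp only [← expect_sum, ← expect_add, expect_bind, expect_pure]
  refine expect_mono fun pp => expect_mono fun a => expect_mono fun π₂ => ?_
  refine (ind_le_add (Q := ∃ j s, V.opened k F.commitLen pp (V.commitVec k F.commitLen pp
      (padTo pad F.commitLen m)) (F.modelPos j) (π₂.1 j) = some s ∧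
      s ≠ padTo pad F.commitLen m (F.modelPos j))
    (R := ∃ j s, V.opened k F.commitLen pp (com k a) (F.tracePos j) (π₂.2 j) = some s ∧
      s ≠ t j k pp a) fun h => ?_).trans (add_le_add (ind_exists_le _) (ind_exists_le _))
  by_contra! hcon
  refine h ⟨fun j s hs => ?_, fun j s hs => hcon.2 j s hs⟩
  rw [← padTo_modelPos F pad m j]
  exact hcon.1 j s hs

/-- A union bound for a commitment phase `f`, uniform coins `u` and a reply phase `g`. -/
theorem expect_ind_le {A B C D : Type} [Fintype A] [Fintype B] [Fintype C] [Fintype D]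
    (p : PMF A) (f : A → PMF B) (u : PMF C) (g : B → C → PMF D) {win : A → B → C → D → Prop}
    {ideal : A → B → C → Prop} {bad : A → B → D → Prop}
    (h : ∀ a b c d, win a b c d → ideal a b c ∨ bad a b d) :
    (expect p fun a => expect (f a) fun b => expect u fun c => expect (g b c) fun d =>
      ind (win a b c d)) ≤
    (expect p fun a => expect (f a) fun b => expect u fun c => ind (ideal a b c)) +
      expect p fun a => expect (f a) fun b => expect (u.bind (g b)) fun d => ind (bad a b d) := by
  simp only [expect_bind, ← expect_add]
  refine expect_mono fun a => expect_mono fun b => expect_mono fun c => ?_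
  -- The ideal event does not involve the reply and may be averaged over it for free.
  rw [← expect_const (g b c) (ind (ideal a b c)), ← expect_add]
  exact expect_mono fun d => ind_le_add (h a b c d)

variable {Dmodel Dmodel' : PMF F.Model} {Dquery : PMF F.Query} {Δ : Y → Y → ℝ} {δ : ℝ} {ε : ℕ → ℝ}

/-- The loss in soundness is the inconsistency probability of the extracted trace, summed over all
pairs of a model and a query. -/
theorem compile_fullSound [Fintype Y] [BitRep Y] (hV : V.IsSecure) (hρ : PolyBdd T.coins)
    (h : T.FullSound Dmodel Dquery Δ δ ε) {s : ℕ → ℕ}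
    {A₁ : ∀ k, Bits (V.ppLen k F.commitLen) × F.Model × F.Query →
      PMF (Y × Bits (V.cmLen k F.commitLen) × Bits (s k))} (hA₁ : PolyRand A₁)
    {A₂ : ∀ k, Bits (s k) × Bits (T.coins k) → PMF (Reply F V k)} (hA₂ : PolyRand A₂) :
    LeUpToNegl (fun k => Pr ((compile F V T pad).fullGame Dmodel Dquery Δ δ A₁ A₂ k)) ε := by
  -- Here `m` and `q` are constants wired into the first phase of the adversary.
  have key := fun (m : F.Model) (q : F.Query) => hV.exists_trace (F := F) pad
    (Γ := fun k => Y × Bits (V.cmLen k F.commitLen) × Bits (s k))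
    (A := fun k pp => A₁ k (pp, m, q))
    (hA₁.comp (PolyDet.id.prodMk (PolyDet.const (PolyWidth.const _) fun _ => (m, q))))
    (com := fun k a => a.2.1) PolyDet.id.snd.fst
    (compile_reply_polyRand hρ hA₂ (st := fun k a => a.2.2) PolyDet.id.snd.snd) m
  choose t ht using key
  refine (Negligible.sum Finset.univ fun m => Negligible.sum Finset.univ fun q =>
    ht m q).leUpToNegl fun k => ?_
  -- The ideal adversary draws the parameters, simulates the commitment phase and outputs the
  -- extracted trace, all before the test coins are drawn.
  have hideal := h (fun k m q => (V.genParams k F.commitLen).bind fun pp =>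
    (A₁ k (pp, m, q)).bind fun a => PMF.pure (t m q k pp a)) k
  have hgame : Pr ((compile F V T pad).fullGame Dmodel Dquery Δ δ A₁ A₂ k) =
      expect Dmodel fun m => expect Dquery fun q => expect (V.genParams k F.commitLen) fun pp =>
        expect (A₁ k (pp, m, q)) fun a =>
        expect (PMF.uniformOfFintype (Bits (T.coins k))) fun ρ =>
        expect (A₂ k (a.2.2, ρ)) fun π₂ =>
          ind (δ < Δ (F.run m q) a.1 ∧ (compile F V T pad).verify k pp
            ((compile F V T pad).commitToModel k pp m) q a.1 a.2.1 π₂ ρ = true) := by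
    -- The game draws the parameters before the query; exchanging the averages makes them part of
    -- the ideal adversary's randomness.
    simp only [expect_comm Dquery (V.genParams k F.commitLen)]
    exact Pr_bind_eq _ fun m => Pr_bind_eq _ fun pp => Pr_bind_eq _ fun q => Pr_bind_eq _ fun a =>
      Pr_bind_eq _ fun ρ => Pr_bind_eq _ fun π₂ => Pr_pure _
  rw [hgame]
  refine (expect_mono fun m => expect_mono fun q => expect_ind_le _ _ _ _
    (ideal := fun pp a ρ => δ < Δ (F.run m q) (F.out (t m q k pp a)) ∧
      (T.test k q ρ).run m (t m q k pp a) = true)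
    (bad := fun pp a π₂ => ¬ Consistent pad pp m (t m q k pp a) a.2.1 π₂)
    fun pp a ρ π₂ hwin => ?_).trans ?_
  · by_cases hc : Consistent pad pp m (t m q k pp a) a.2.1 π₂
    · obtain ⟨ho, hr⟩ := hc.accepts hwin.2
      exact Or.inl ⟨by rw [ho]; exact hwin.1, hr⟩
    · exact Or.inr hc
  · simp only [expect_add]
    refine add_le_add ?_ ?_
    · simp only [Tester.fullGame, Pr_bind, Pr_pure, expect_bind, expect_pure] at hideal
      exact hideal
    · refine (expect_le_sum _ fun _ => expect_nonneg fun _ => expect_nonneg fun _ =>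
        expect_nonneg fun _ => expect_nonneg fun _ => ind_nonneg _).trans ?_
      exact Finset.sum_le_sum fun m _ => expect_le_sum _ fun _ => expect_nonneg fun _ =>
        expect_nonneg fun _ => expect_nonneg fun _ => ind_nonneg _

/-- The extraction is that of full soundness, with the second model wired in as well. Consistency
and acceptance force the extracted trace to carry the output of that model, as the ideal game
requires. -/
theorem compile_strongOtherModelSound (hV : V.IsSecure) (hρ : PolyBdd T.coins)
    (h : T.StrongOtherModelSound Dmodel Dmodel' Dquery Δ δ ε) {s : ℕ → ℕ}
    {A₁ : ∀ k, Bits (V.ppLen k F.commitLen) × F.Model × F.Query × F.Model →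
      PMF (Bits (V.cmLen k F.commitLen) × Bits (s k))} (hA₁ : PolyRand A₁)
    {A₂ : ∀ k, Bits (s k) × Bits (T.coins k) → PMF (Reply F V k)} (hA₂ : PolyRand A₂) :
    LeUpToNegl (fun k => Pr
      ((compile F V T pad).strongOtherModelGame Dmodel Dmodel' Dquery Δ δ A₁ A₂ k)) ε := by
  have key := fun (m m' : F.Model) (q : F.Query) => hV.exists_trace (F := F) pad
    (Γ := fun k => Bits (V.cmLen k F.commitLen) × Bits (s k))
    (A := fun k pp => A₁ k (pp, m, q, m'))
    (hA₁.comp (PolyDet.id.prodMk (PolyDet.const (PolyWidth.const _) fun _ => (m, q, m'))))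
    (com := fun k a => a.1) PolyDet.id.fst
    (compile_reply_polyRand hρ hA₂ (st := fun k a => a.2) PolyDet.id.snd) m
  choose t ht using key
  refine (Negligible.sum Finset.univ fun m => Negligible.sum Finset.univ fun m' =>
    Negligible.sum Finset.univ fun q => ht m m' q).leUpToNegl fun k => ?_
  have hideal := h (fun k m q m' => (V.genParams k F.commitLen).bind fun pp =>
    (A₁ k (pp, m, q, m')).bind fun a => PMF.pure (t m m' q k pp a)) k
  have hgame : Pr ((compile F V T pad).strongOtherModelGame Dmodel Dmodel' Dquery Δ δ A₁ A₂ k) =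
      expect Dmodel fun m => expect Dmodel' fun m' => expect Dquery fun q =>
        expect (V.genParams k F.commitLen) fun pp =>
        expect (A₁ k (pp, m, q, m')) fun a =>
        expect (PMF.uniformOfFintype (Bits (T.coins k))) fun ρ =>
        expect (A₂ k (a.2, ρ)) fun π₂ =>
          ind (δ < Δ (F.run m q) (F.run m' q) ∧ (compile F V T pad).verify k pp
            ((compile F V T pad).commitToModel k pp m) q (F.run m' q) a.1 π₂ ρ = true) := by
    simp only [expect_comm Dquery (V.genParams k F.commitLen),
      expect_comm Dmodel' (V.genParams k F.commitLen)]
    exact Pr_bind_eq _ fun m => Pr_bind_eq _ fun pp => Pr_bind_eq _ fun m' => Pr_bind_eq _ fun q =>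
      Pr_bind_eq _ fun a => Pr_bind_eq _ fun ρ => Pr_bind_eq _ fun π₂ => Pr_pure _
  rw [hgame]
  refine (expect_mono fun m => expect_mono fun m' => expect_mono fun q => expect_ind_le _ _ _ _
    (ideal := fun pp a ρ => δ < Δ (F.run m q) (F.run m' q) ∧
      F.out (t m m' q k pp a) = F.run m' q ∧ (T.test k q ρ).run m (t m m' q k pp a) = true)
    (bad := fun pp a π₂ => ¬ Consistent pad pp m (t m m' q k pp a) a.1 π₂)
    fun pp a ρ π₂ hwin => ?_).trans ?_
  · by_cases hc : Consistent pad pp m (t m m' q k pp a) a.1 π₂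
    · exact Or.inl ⟨hwin.1, hc.accepts hwin.2⟩
    · exact Or.inr hc
  · simp only [expect_add]
    refine add_le_add ?_ ?_
    · simp only [Tester.strongOtherModelGame, Pr_bind, Pr_pure, expect_bind, expect_pure] at hideal
      exact hideal
    · refine (expect_le_sum _ fun _ => expect_nonneg fun _ => expect_nonneg fun _ =>
        expect_nonneg fun _ => expect_nonneg fun _ => expect_nonneg fun _ => ind_nonneg _).trans ?_
      refine Finset.sum_le_sum fun m _ => (expect_le_sum _ fun _ => expect_nonneg fun _ =>
        expect_nonneg fun _ => expect_nonneg fun _ => expect_nonneg fun _ => ind_nonneg _).trans ?_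
      exact Finset.sum_le_sum fun m' _ => expect_le_sum _ fun _ => expect_nonneg fun _ =>
        expect_nonneg fun _ => expect_nonneg fun _ => ind_nonneg _

end Compile

/-! ### Auxiliary facts on games, circuits and differing models -/

theorem Pr_pure_bind {α : Type} (a : α) (f : α → PMF Prop) : Pr (PMF.pure a >>= f) = Pr (f a) :=
  congrArg Pr (PMF.pure_bind a f)

namespace PolyDet

variable {α β : ℕ → Type} [∀ k, BitRep (α k)] [∀ k, BitRep (β k)]

theorem congr {f g : ∀ k, α k → β k} (hf : PolyDet f) (h : ∀ k x, g k x = f k x) : PolyDet g := by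
  have : g = f := funext fun k => funext (h k)
  rwa [this]

theorem some (hβ : PolyWidth β) {f : ∀ k, α k → β k} (hf : PolyDet f) :
    PolyDet (fun k x => Option.some (f k x)) :=
  guard hβ (const (PolyWidth.const Bool) fun _ => true) hf

end PolyDet

open Classical in
/-- A position at which the two models differ, if there is one. -/
noncomputable def diffPos {S Y : Type} (F : ModelFamily S Y) (a : F.Model × F.Model) : Fin F.commitLen :=
  if h : ∃ j, a.1 j ≠ a.2 j then F.modelPos h.choose else F.modelPos ⟨0, F.nModel_pos⟩

theorem padTo_diffPos_ne {S Y : Type} (F : ModelFamily S Y) (pad : S) {a : F.Model × F.Model} (h : a.1 ≠ a.2) :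
    padTo pad F.commitLen a.2 (diffPos F a) ≠ padTo pad F.commitLen a.1 (diffPos F a) := by
  have h' := Function.ne_iff.1 h
  rw [diffPos, dif_pos h', padTo_modelPos, padTo_modelPos]
  exact h'.choose_spec.symm

section Compile

variable {S Y : Type} [BitRep S] {F : ModelFamily S Y} {V : VectorCommitment S}
  {T : Tester F} {pad : S}

/-! ## The honest prover -/

variable (F V T pad) in
/-- The last message of the prover who has committed to the trace `t` and uses the model `m`. -/
def honestReply (k : ℕ) (pp : Bits (V.ppLen k F.commitLen)) (m : F.Model) (q : F.Query)
    (t : F.Trace) (ρ : Bits (T.coins k)) : Reply F V k :=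
  (fun j => if j ∈ (T.test k q ρ).modelReads m t then
      some (m j, V.openAt k F.commitLen pp (padTo pad F.commitLen m) (F.modelPos j)) else none,
    fun j => if j ∈ (T.test k q ρ).traceReads m t ∪ F.idxsOut then
      some (t j, V.openAt k F.commitLen pp (padTo pad F.commitLen t) (F.tracePos j)) else none)

theorem honestReply_accepted {k : ℕ} {pp : Bits (V.ppLen k F.commitLen)} (hV : V.Correct F.commitLen)
    (hT : T.Correct) (hpp : pp ∈ (V.genParams k F.commitLen).support) (m : F.Model) (q : F.Query)
    (ρ : Bits (T.coins k)) : (compile F V T pad).verify k pp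
      (V.commitVec k F.commitLen pp (padTo pad F.commitLen m)) q (F.run m q)
      (V.commitVec k F.commitLen pp (padTo pad F.commitLen (F.evalTrace m q)))
      (honestReply F V T pad k pp m q (F.evalTrace m q) ρ) ρ = true := by
  refine compile_verify_iff.2 ⟨?_, fun j a ha => ?_, fun j a ha => ?_,
    fun j => F.evalTrace m q j.1, fun j => ?_, rfl⟩
  · rw [Probe.runPartial_of_reads (m := m) (t := F.evalTrace m q), hT]
    · intro j hj
      simp [honestReply, hj]
    · intro j hj
      simp [honestReply, hj]
  · simp only [honestReply] at ha
    split_ifs at ha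
    cases ha
    dsimp only
    rw [← padTo_modelPos F pad m j]
    exact hV k pp hpp _ _
  · simp only [honestReply] at ha
    split_ifs at ha
    cases ha
    dsimp only
    rw [← padTo_tracePos F pad (F.evalTrace m q) j]
    exact hV k pp hpp _ _
  · simp [honestReply]

/-! ## Efficiency of the compiled protocol -/

theorem polyDet_map_fst (hV : V.IsSecure) (pad : S) {n : ℕ} {α : ℕ → Type} [∀ k, BitRep (α k)]
    {f : ∀ k, α k → Option (S × Bits (V.proofLen k n))} (hf : PolyDet f) :
    PolyDet (fun k x => (f k x).map Prod.fst) := by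
  have hw : PolyWidth (fun k => S × Bits (V.proofLen k n)) :=
    (PolyWidth.const S).prod (hV.polyWidth_proof n)
  refine (PolyDet.guard (PolyWidth.const S) hf.isSome
    (hf.getD hw fun _ => (pad, fun _ => false)).fst).congr fun k x => ?_
  cases f k x <;> rfl

theorem honestReply_polyDet (hV : V.IsSecure) (hT : T.IsEfficient) :
    PolyDet (fun k (x : (Bits (V.ppLen k F.commitLen) × F.Model × F.Query × F.Trace) ×
      Bits (T.coins k)) => honestReply F V T pad k x.1.1 x.1.2.1 x.1.2.2.1 x.1.2.2.2 x.2) := by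
  have hw : PolyWidth (fun k => S × Bits (V.proofLen k F.commitLen)) :=
    (PolyWidth.const S).prod (hV.polyWidth_proof F.commitLen)
  have hopen := EfficientDet.polyDet (hV F.commitLen).1.2.2.1
  have hx : PolyDet (fun k (x : (Bits (V.ppLen k F.commitLen) × F.Model × F.Query × F.Trace) ×
      Bits (T.coins k)) => x) := PolyDet.id
  -- The test comes with a record of the positions it reads; these bits decide which entries are
  -- sent.
  have hrun := hT.polyDet.comp (hx.fst.snd.fst.prodMk (hx.fst.snd.snd.snd.prodMk
    (hx.fst.snd.snd.fst.prodMk hx.snd)))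
  have hM := PolyDet.pi fun j : Fin F.nModel => PolyDet.guard hw (hrun.snd.fst.apply j)
    ((hx.fst.snd.fst.apply j).prodMk (hopen.comp (hx.fst.fst.prodMk
      (hx.fst.snd.fst.finite fun _ m => (padTo pad F.commitLen m, F.modelPos j)))))
  have hI := PolyDet.pi fun j : Fin F.nTrace => PolyDet.guard hw
    ((hrun.snd.snd.apply j).finite fun _ b => b || decide (j ∈ F.idxsOut))
    ((hx.fst.snd.snd.snd.apply j).prodMk (hopen.comp (hx.fst.fst.prodMk
      (hx.fst.snd.snd.snd.finite fun _ t => (padTo pad F.commitLen t, F.tracePos j)))))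
  refine (hM.prodMk hI).congr fun k x => ?_
  simp [honestReply]

theorem compile_verify_polyDet [BitRep Y] (hV : V.IsSecure) (hT : T.IsEfficient) :
    PolyDet (fun k (x : Bits (V.ppLen k F.commitLen) × Bits (V.cmLen k F.commitLen) × F.Query × Y ×
      Bits (V.cmLen k F.commitLen) × Reply F V k × Bits (T.coins k)) =>
      (compile F V T pad).verify k x.1 x.2.1 x.2.2.1 x.2.2.2.1 x.2.2.2.2.1 x.2.2.2.2.2.1
        x.2.2.2.2.2.2) := by
  classical
  have hw : PolyWidth (fun k => S × Bits (V.proofLen k F.commitLen)) :=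
    (PolyWidth.const S).prod (hV.polyWidth_proof F.commitLen)
  have hver := EfficientDet.polyDet (hV F.commitLen).1.2.2.2
  have hx : PolyDet (fun k (x : Bits (V.ppLen k F.commitLen) × Bits (V.cmLen k F.commitLen) ×
      F.Query × Y × Bits (V.cmLen k F.commitLen) × Reply F V k × Bits (T.coins k)) => x) :=
    PolyDet.id
  have hr := hx.snd.snd.snd.snd.snd.fst
  have hM := PolyDet.pi fun j => polyDet_map_fst hV pad (hr.fst.apply j)
  have hI := PolyDet.pi fun j => polyDet_map_fst hV pad (hr.snd.apply j)
  have hvM := PolyDet.pi fun j => hver.comp (hx.fst.prodMk (hx.snd.fst.prodMk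
    ((PolyDet.const (PolyWidth.const _) fun _ => F.modelPos j).prodMk
      ((hr.fst.apply j).getD hw fun _ => (pad, fun _ => false)))))
  have hvI := PolyDet.pi fun j => hver.comp (hx.fst.prodMk (hx.snd.snd.snd.snd.fst.prodMk
    ((PolyDet.const (PolyWidth.const _) fun _ => F.tracePos j).prodMk
      ((hr.snd.apply j).getD hw fun _ => (pad, fun _ => false)))))
  -- The test is efficient on full strings. Gaps are filled with `pad`, and the recorded positions
  -- reveal whether a filled-in entry was read.
  have hrun := hT.polyDet.comp ((hM.finite fun _ m j => (m j).getD pad).prodMk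
    ((hI.finite fun _ t j => (t j).getD pad).prodMk (hx.snd.snd.fst.prodMk
      hx.snd.snd.snd.snd.snd.snd)))
  -- What remains to be combined lives in sets that do not depend on the security parameter, so the
  -- final decision costs a constant number of gates.
  refine ((hrun.prodMk (hM.prodMk (hI.prodMk (hvM.prodMk (hvI.prodMk
    hx.snd.snd.snd.fst))))).finite fun _ z => decide (
      (z.1.1 = true ∧ (∀ j, z.1.2.1 j = true → (z.2.1 j).isSome = true) ∧
        ∀ j, z.1.2.2 j = true → (z.2.2.1 j).isSome = true) ∧
      (∀ j, (z.2.1 j).isSome = true → z.2.2.2.1 j = true) ∧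
      (∀ j, (z.2.2.1 j).isSome = true → z.2.2.2.2.1 j = true) ∧
      ∃ vals : {j // j ∈ F.idxsOut} → S,
        (∀ j, z.2.2.1 j.1 = some (vals j)) ∧ F.fOut vals = z.2.2.2.2.2)).congr fun k x => ?_
  have hopt : ∀ (o : Option (S × Bits (V.proofLen k F.commitLen)))
      (P : S × Bits (V.proofLen k F.commitLen) → Prop),
      (∀ a, o = some a → P a) ↔
        ((o.map Prod.fst).isSome = true → P (o.getD (pad, fun _ => false))) := by
    rintro (_ | a) P <;> simp
  rw [Bool.eq_iff_iff, compile_verify_iff, decide_eq_true_iff, Probe.runPartial_eq_true_iff pad]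
  simp only [decide_eq_true_iff, hopt]

theorem compile_efficient [BitRep Y] (hV : V.IsSecure) (hT : T.IsEfficient) :
    (compile F V T pad).IsEfficient := by
  have hρ : PolyWidth (fun k => Bits (T.coins k)) :=
    PolyWidth.snd (PolyWidth.snd (PolyWidth.snd (Efficient.polyWidth_left hT)))
  have hpp := hV.polyWidth_pp F.commitLen
  have hcm := hV.polyWidth_cm F.commitLen
  have hw : PolyWidth (fun k => S × Bits (V.proofLen k F.commitLen)) :=
    (PolyWidth.const S).prod (hV.polyWidth_proof F.commitLen)
  have hreply : PolyWidth (fun k => Reply F V k) := (hw.option.pi _).prod (hw.option.pi _)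
  have hstate : PolyWidth (fun k => Bits (V.ppLen k F.commitLen) × F.Model × F.Query × F.Trace) :=
    hpp.prod (PolyWidth.const _)
  have hcommit := EfficientDet.polyDet (hV F.commitLen).1.2.1
  have h₀ : PolyDet (fun k (x : Bits (V.ppLen k F.commitLen) × F.Model) =>
      V.commitVec k F.commitLen x.1 (padTo pad F.commitLen x.2)) :=
    hcommit.comp (PolyDet.id.fst.prodMk (PolyDet.id.snd.finite fun _ => padTo pad F.commitLen))
  have h₁ : PolyDet (fun k (x : Bits (V.ppLen k F.commitLen) × F.Model × F.Query) =>
      (V.commitVec k F.commitLen x.1 (padTo pad F.commitLen (F.evalTrace x.2.1 x.2.2)),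
        (x.1, x.2.1, x.2.2, F.evalTrace x.2.1 x.2.2))) :=
    (hcommit.comp (PolyDet.id.fst.prodMk (PolyDet.id.snd.finite fun _ (y : F.Model × F.Query) =>
      padTo pad F.commitLen (F.evalTrace y.1 y.2)))).prodMk
    (PolyDet.id.fst.prodMk (PolyDet.id.snd.finite
      fun _ (y : F.Model × F.Query) => (y.1, y.2, F.evalTrace y.1 y.2)))
  refine ⟨(hV F.commitLen).1.1, ?_, ?_, ?_, ?_⟩
  · exact h₀.efficientDet (hpp.prod (PolyWidth.const _)) hcm
  · exact h₁.polyRand.efficient (hpp.prod (PolyWidth.const _)) (hcm.prod hstate)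
  · exact (honestReply_polyDet hV hT).polyRand.efficient (hstate.prod hρ) hreply
  · exact (compile_verify_polyDet hV hT).efficientDet (hpp.prod (hcm.prod ((PolyWidth.const _).prod
      ((PolyWidth.const Y).prod (hcm.prod (hreply.prod hρ)))))) (PolyWidth.const Bool)

/-! ## Correctness and security -/

theorem compile_correct (hV : V.Correct F.commitLen) (hT : T.Correct) :
    (compile F V T pad).Correct := by
  intro k m q
  have hgame : Pr ((compile F V T pad).honestGame m q k) =
      expect (V.genParams k F.commitLen) fun pp =>
        expect (PMF.uniformOfFintype (Bits (T.coins k))) fun ρ =>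
          ind ((compile F V T pad).verify k pp
            (V.commitVec k F.commitLen pp (padTo pad F.commitLen m)) q (F.run m q)
            (V.commitVec k F.commitLen pp (padTo pad F.commitLen (F.evalTrace m q)))
            (honestReply F V T pad k pp m q (F.evalTrace m q) ρ) ρ = true) :=
    Pr_bind_eq _ fun pp => (Pr_pure_bind _ _).trans <| Pr_bind_eq _ fun ρ =>
      (Pr_pure_bind _ _).trans (Pr_pure _)
  rw [hgame, ← expect_const (V.genParams k F.commitLen) 1]
  -- Honest openings are guaranteed to verify only for parameters that can occur.
  refine expect_congr_support fun pp hpp => ?_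
  rw [← expect_const (PMF.uniformOfFintype (Bits (T.coins k))) 1]
  exact expect_congr_support fun ρ _ => ind_of_true (honestReply_accepted hV hT hpp m q ρ)

variable [Fintype S] {Dmodel Dmodel' : PMF F.Model} {Dquery : PMF F.Query} {Δ : Y → Y → ℝ} {δ : ℝ} {ε : ℕ → ℝ}

/-- The honest prover's trace openings carry the true trace values whether or not they verify, so
only its model openings can be inconsistent. Those are honest openings of `m'` checked against the
digest of `m`. They depend on the parameters alone, so no reply has to be repeated and no challenge
simulated. -/
theorem compile_otherModelSound (hV : V.IsSecure)
    (h : T.OtherModelSound Dmodel Dmodel' Dquery Δ δ ε) :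
    (compile F V T pad).OtherModelSoundUpToNegl Dmodel Dmodel' Dquery Δ δ ε := by
  have hw : PolyWidth (fun k => S × Bits (V.proofLen k F.commitLen)) :=
    (PolyWidth.const S).prod (hV.polyWidth_proof F.commitLen)
  have hopen := EfficientDet.polyDet (hV F.commitLen).1.2.2.1
  have key := fun (m m' : F.Model) (j : Fin F.nModel) => hV.negligible_opened_ne (n := F.commitLen)
    pad (Γ := fun k => Bits (V.ppLen k F.commitLen)) (A := fun k pp => PMF.pure pp)
    PolyDet.id.polyRand (W := fun k pp => PMF.pure (some (m' j,
      V.openAt k F.commitLen pp (padTo pad F.commitLen m') (F.modelPos j))))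
    (PolyDet.some hw ((PolyDet.const (PolyWidth.const S) fun _ => m' j).prodMk
      (hopen.comp (PolyDet.id.prodMk (PolyDet.const (PolyWidth.const _) fun _ =>
        (padTo pad F.commitLen m', F.modelPos j)))))).polyRand
    (padTo pad F.commitLen m) (F.modelPos j)
  refine (Negligible.sum Finset.univ fun m => Negligible.sum Finset.univ fun m' =>
    Negligible.sum Finset.univ fun j => key m m' j).leUpToNegl fun k => ?_
  have hideal := h k
  simp only [Tester.otherModelGame, Pr_bind, Pr_pure] at hideal
  have hgame : Pr ((compile F V T pad).otherModelGame Dmodel Dmodel' Dquery Δ δ k) =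
      expect Dmodel fun m => expect Dmodel' fun m' => expect Dquery fun q =>
        expect (V.genParams k F.commitLen) fun pp =>
        expect (PMF.uniformOfFintype (Bits (T.coins k))) fun ρ =>
          ind (δ < Δ (F.run m q) (F.run m' q) ∧ (compile F V T pad).verify k pp
            ((compile F V T pad).commitToModel k pp m) q (F.run m' q)
            (V.commitVec k F.commitLen pp (padTo pad F.commitLen (F.evalTrace m' q)))
            (honestReply F V T pad k pp m' q (F.evalTrace m' q) ρ) ρ = true) := by
    simp only [expect_comm Dquery (V.genParams k F.commitLen),
      expect_comm Dmodel' (V.genParams k F.commitLen)]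
    exact Pr_bind_eq _ fun m => Pr_bind_eq _ fun pp => Pr_bind_eq _ fun m' => Pr_bind_eq _ fun q =>
      (Pr_pure_bind _ _).trans <| Pr_bind_eq _ fun ρ => (Pr_pure_bind _ _).trans (Pr_pure _)
  -- All model positions are counted, not only those read, which makes the bad event independent of
  -- query and challenge.
  let bad : F.Model → F.Model → Bits (V.ppLen k F.commitLen) → ℝ := fun m m' pp =>
    ∑ j, ind (∃ s, V.opened k F.commitLen pp (V.commitVec k F.commitLen pp
      (padTo pad F.commitLen m)) (F.modelPos j) (some (m' j,
        V.openAt k F.commitLen pp (padTo pad F.commitLen m') (F.modelPos j))) = some s ∧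
      s ≠ padTo pad F.commitLen m (F.modelPos j))
  have hbad : ∀ m m', 0 ≤ expect (V.genParams k F.commitLen) (bad m m') := fun m m' =>
    expect_nonneg fun _ => Finset.sum_nonneg fun _ _ => ind_nonneg _
  have hwin : ∀ m m' q (pp : Bits (V.ppLen k F.commitLen)) (ρ : Bits (T.coins k)), ind (δ < Δ (F.run m q) (F.run m' q) ∧
      (compile F V T pad).verify k pp ((compile F V T pad).commitToModel k pp m) q (F.run m' q)
        (V.commitVec k F.commitLen pp (padTo pad F.commitLen (F.evalTrace m' q)))
        (honestReply F V T pad k pp m' q (F.evalTrace m' q) ρ) ρ = true) ≤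
      ind (δ < Δ (F.run m q) (F.run m' q) ∧ (T.test k q ρ).run m (F.evalTrace m' q) = true) +
        bad m m' pp := by
    refine fun m m' q pp ρ => (ind_le_add fun hwin => ?_).trans
      (add_le_add le_rfl (ind_exists_le _))
    by_contra hcon
    rw [not_or] at hcon
    obtain ⟨hideal, hbad⟩ := hcon
    push Not at hbad
    refine hideal ⟨hwin.1, (Consistent.accepts (pad := pad) ⟨fun j s hs => ?_, fun j s hs => ?_⟩
      hwin.2).2⟩
    · simp only [honestReply] at hs
      split_ifs at hs
      · exact (hbad j s hs).trans (padTo_modelPos F pad m j)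
      · cases hs
    · obtain ⟨π, hπ, -⟩ := V.opened_eq_some hs
      simp only [honestReply] at hπ
      split_ifs at hπ
      cases hπ
      rfl
  refine hgame.le.trans ((expect_mono fun m => expect_mono fun m' => expect_mono fun q =>
    expect_mono fun pp => expect_mono fun ρ => hwin m m' q pp ρ).trans ?_)
  simp only [expect_add, expect_const]
  refine add_le_add hideal ?_
  refine (expect_le_sum _ fun m => expect_nonneg (hbad m)).trans ?_
  refine (Finset.sum_le_sum fun m _ => expect_le_sum _ (hbad m)).trans (le_of_eq ?_)
  simp only [expect_pure, bad, expect_sum]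

/-! ## Binding of the digest -/

/-- If two distinct models share a digest, the honest opening of the second at a position where they
differ is an accepting opening of the first one's commitment to a wrong value. -/
theorem compile_binding_game (hV : V.IsSecure)
    {A : ∀ k, Bits (V.ppLen k F.commitLen) → PMF (F.Model × F.Model)} (hA : PolyRand A) :
    LeUpToNegl (fun k => Pr ((compile F V T pad).bindingGame A k)) 0 := by
  let B : ∀ k, Bits (V.ppLen k F.commitLen) → PMF ((Fin F.commitLen → S) × Fin F.commitLen × S ×
      Bits (V.proofLen k F.commitLen)) := fun k pp => (A k pp).bind fun a =>
    PMF.pure (padTo pad F.commitLen a.1, diffPos F a, padTo pad F.commitLen a.2 (diffPos F a),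
      V.openAt k F.commitLen pp (padTo pad F.commitLen a.2) (diffPos F a))
  have hopen := EfficientDet.polyDet (hV F.commitLen).1.2.2.1
  have hB : PolyRand B := by
    refine PolyRand.bind hA (g := fun k x => PMF.pure (padTo pad F.commitLen x.2.1, diffPos F x.2,
      padTo pad F.commitLen x.2.2 (diffPos F x.2),
      V.openAt k F.commitLen x.1 (padTo pad F.commitLen x.2.2) (diffPos F x.2))) ?_
    exact ((PolyDet.id.snd.finite fun _ a => padTo pad F.commitLen a.1).prodMk
      ((PolyDet.id.snd.finite fun _ a => diffPos F a).prodMk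
      ((PolyDet.id.snd.finite fun _ a => padTo pad F.commitLen a.2 (diffPos F a)).prodMk
      (hopen.comp (PolyDet.id.fst.prodMk (PolyDet.id.snd.finite fun _ a =>
        (padTo pad F.commitLen a.2, diffPos F a))))))).polyRand
  obtain ⟨ν, hν, hle⟩ := (hV F.commitLen).2.2.2 B (hB.efficient (hV.polyWidth_pp _)
    ((PolyWidth.const _).prod ((PolyWidth.const _).prod ((PolyWidth.const _).prod
      (hV.polyWidth_proof _)))))
  refine ⟨ν, hν, fun k => le_trans ?_ (hle k)⟩
  have hgame : Pr ((compile F V T pad).bindingGame A k) =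
      expect (V.genParams k F.commitLen) fun pp => expect (A k pp) fun a =>
        ind (a.1 ≠ a.2 ∧ V.commitVec k F.commitLen pp (padTo pad F.commitLen a.1) =
          V.commitVec k F.commitLen pp (padTo pad F.commitLen a.2)) :=
    Pr_bind_eq _ fun pp => Pr_bind_eq _ fun a => Pr_pure _
  refine hgame.le.trans ?_
  dsimp only
  rw [VectorCommitment.positionBindingGame, Pr_bind]
  refine expect_mono_support fun pp hpp => ?_
  rw [Pr_bind, expect_bind]
  simp only [expect_pure, Pr_pure]
  refine expect_mono fun a => ind_mono fun ⟨hne, heq⟩ => ⟨padTo_diffPos_ne F pad hne, ?_⟩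
  rw [heq]
  exact (hV F.commitLen).2.1 k pp hpp _ _

end Compile

/-! ### The security theorem -/

theorem theorem2 {S Y : Type} [BitRep S] [BitRep Y]
    (F : ModelFamily S Y)
    (V : VectorCommitment S) (hV : V.IsSecure)
    (T : Tester F) (hTeff : T.IsEfficient) (hTcorrect : T.Correct)
    (pad : S)
    (Dmodel Dmodel' : PMF F.Model) (Dquery : PMF F.Query)
    (Δ : Y → Y → ℝ) (δ : ℝ) (ε : ℕ → ℝ) :
    ((compile F V T pad).IsEfficient ∧ (compile F V T pad).Binding ∧
      (compile F V T pad).Correct) ∧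
    (T.FullSound Dmodel Dquery Δ δ ε →
      (compile F V T pad).FullSoundUpToNegl Dmodel Dquery Δ δ ε) ∧
    (T.OtherModelSound Dmodel Dmodel' Dquery Δ δ ε →
      (compile F V T pad).OtherModelSoundUpToNegl Dmodel Dmodel' Dquery Δ δ ε) ∧
    (T.StrongOtherModelSound Dmodel Dmodel' Dquery Δ δ ε →
      (compile F V T pad).StrongOtherModelSoundUpToNegl Dmodel Dmodel' Dquery Δ δ ε) := by
  let _ := @Fintype.ofFinite S (BitRep.finite S)
  let _ := @Fintype.ofFinite Y (BitRep.finite Y)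
  -- The test coins are among the inputs counted by the efficiency of the test.
  have hρ : PolyBdd T.coins := PolyWidth.polyBdd_of_bits
    (PolyWidth.snd (PolyWidth.snd (PolyWidth.snd (Efficient.polyWidth_left hTeff))))
  refine ⟨⟨compile_efficient hV hTeff, ?_, compile_correct (hV _).2.1 hTcorrect⟩, ?_,
    compile_otherModelSound hV, ?_⟩
  · intro A hA
    exact compile_binding_game hV (Efficient.polyRand hA)
  · intro h s A₁ A₂ hA₁ hA₂
    exact compile_fullSound hV hρ h (Efficient.polyRand hA₁) (Efficient.polyRand hA₂)
  · intro h s A₁ A₂ hA₁ hA₂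
    exact compile_strongOtherModelSound hV hρ h (Efficient.polyRand hA₁) (Efficient.polyRand hA₂)
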